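/- Let ${\bf H}^2_{\mathbb C}$ be the complex hyperbolic plane, i.e. the negative lines in $\mathbb C^3$ for the Hermitian form $\langle x,y\rangle=x_1\bar y_3+x_2\bar y_2+x_3\bar y_1$ of signature $(2,1)$, with the metric of holomorphic sectional curvature $-1$, and let ${\rm SU}(2,1)$ be the special unitary group of this form. Points of $\partial{\bf H}^2_{\mathbb C}$ are the null lines. An element of ${\rm SU}(2,1)$ is a Heisenberg translation at $p\in\partial{\bf H}^2_{\mathbb C}$ if it fixes $p$ and some scalar multiple of it is unipotent (scalar matrices are included). Let $\Gamma$ be a discrete subgroup of ${\rm SU}(2,1)$ and let $\Gamma_\infty$ be a parabolic subgroup of $\Gamma$ fixing a point $p$ of $\partial{\bf H}^2_{\mathbb C}$. Let $\Lambda_\infty$ be the subgroup of all Heisenberg translations at $p$ in $\Gamma_\infty$, assumed non-abelian (equivalently, since $\Gamma$ is discrete, a lattice of Heisenberg translations modulo scalars), and let $m=[\Gamma_\infty:\Lambda_\infty]$. Let $T\in{\rm SU}(2,1)$ be a unipotent matrix that generates the centre $Z(\Gamma_\infty)$ up to scalar matrices, i.e. the images of $\langle T\rangle$ and of $Z(\Gamma_\infty)$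 in ${\rm PU}(2,1)$ coincide. Let $q$ be the positive integer such that the shortest non-trivial commutator in $\Lambda_\infty$ is $T^{q}$, i.e. $q$ is the least integer $k\ge1$ for which $T^k\neq 1$ is a commutator of two elements of $\Lambda_\infty$. Let $C$ be any element of $\Gamma-\Gamma_\infty$. If $B_\infty$ is any (open) horoball that is precisely invariant under $\Gamma_\infty$ in $\Gamma$, i.e. $g(B_\infty)=B_\infty$ for all $g\in\Gamma_\infty$ and $g(B_\infty)\cap B_\infty=\emptyset$ for all $g\in\Gamma-\Gamma_\infty$, then ${\rm tr}(TCTC^{-1})$ is real and $$ {\rm Vol}(\Gamma_\infty\backslash B_\infty)\le\frac{\bigl(3-{\rm tr}(TCTC^{-1})\bigr)\,q}{2m}, $$ where ${\rm Vol}(\Gamma_\infty\backslash B_\infty)$ is the volume of the quotient, i.e. of a fundamental domain for the action of $\Gamma_\infty$ on $B_\infty$. -/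

import Mathlib

open MeasureTheory Matrix
open scoped ENNReal ComplexConjugate MatrixGroups

noncomputable section

namespace CHyp

/-- The Hermitian form `x₀ ȳ₂ + x₁ ȳ₁ + x₂ ȳ₀` of signature `(2,1)` on `ℂ³`. -/
def herm (x y : Fin 3 → ℂ) : ℂ :=
  x 0 * conj (y 2) + x 1 * conj (y 1) + x 2 * conj (y 0)

/-- `SU(2,1)`: the matrices of determinant one that preserve the Hermitian form. -/
def SU21 : Subgroup SL(3, ℂ) where
  carrier := {g | ∀ x y, herm (g.1 *ᵥ x) (g.1 *ᵥ y) = herm x y}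
  one_mem' := by intro x y; simp
  mul_mem' := by
    intro a b ha hb x y
    have h := ha (b.1 *ᵥ x) (b.1 *ᵥ y)
    simp only [Set.mem_ofPred_eq] at hb
    simpa [Matrix.mulVec_mulVec, hb x y] using h
  inv_mem' := by
    intro a ha x y
    have e : ∀ z, a.1 *ᵥ ((a⁻¹).1 *ᵥ z) = z := by
      intro z
      rw [Matrix.mulVec_mulVec, ← Matrix.SpecialLinearGroup.coe_mul]
      simp
    have h := ha ((a⁻¹).1 *ᵥ x) ((a⁻¹).1 *ᵥ y)
    rw [e, e] at h
    exact h.symm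

/-- The underlying matrix of an element of `SU(2,1)`. -/
def mat (g : SU21) : Matrix (Fin 3) (Fin 3) ℂ := g.1.1

/-- The elements of `SU(2,1)` that are scalar matrices, i.e. that act trivially on the complex
hyperbolic plane. -/
def scalars : Subgroup SU21 where
  carrier := {g | ∃ c : ℂ, mat g = c • (1 : Matrix (Fin 3) (Fin 3) ℂ)}
  one_mem' := ⟨1, by simp [mat]⟩
  mul_mem' := by
    rintro a b ⟨c, hc⟩ ⟨d, hd⟩
    refine ⟨c * d, ?_⟩
    have : mat (a * b) = mat a * mat b := by simp [mat]
    rw [this, hc, hd]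
    simp [smul_smul, mul_comm]
  inv_mem' := by
    rintro a ⟨c, hc⟩
    have h1 : mat a * mat a⁻¹ = 1 := by
      have : mat (a * a⁻¹) = mat a * mat a⁻¹ := by
        simp only [mat, Subgroup.coe_mul, Matrix.SpecialLinearGroup.coe_mul]
      rw [← this]; simp [mat]
    rw [hc] at h1
    have hc0 : c ≠ 0 := by
      rintro rfl
      simp at h1
    refine ⟨c⁻¹, ?_⟩
    have h2 : c • mat a⁻¹ = 1 := by simpa using h1
    rw [← h2, smul_smul, inv_mul_cancel₀ hc0, one_smul]

/-! ### The complex hyperbolic plane, as the Siegel domain in `ℂ²` -/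

/-- The standard lift of a point of `ℂ²` to `ℂ³`. -/
def lift (z : ℂ × ℂ) : Fin 3 → ℂ := ![z.1, z.2, 1]

/-- The complex hyperbolic plane: the negative lines of `ℂ³`. Every negative vector has a non-zero
last coordinate, so that the affine chart `lift` sees all of them. -/
def plane : Set (ℂ × ℂ) := {z | (herm (lift z) (lift z)).re < 0}

/-- The action of `SU(2,1)` on the complex hyperbolic plane by projective transformations. -/
def act (g : SU21) (z : ℂ × ℂ) : ℂ × ℂ :=
  ((mat g *ᵥ lift z) 0 / (mat g *ᵥ lift z) 2, (mat g *ᵥ lift z) 1 / (mat g *ᵥ lift z) 2)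

/-- The complex hyperbolic (Bergman) metric, with holomorphic sectional curvature `-1`, as a
Hermitian form on the tangent space `ℂ²` at `z`:
`4 (⟨X, Z⟩⟨Z, Y⟩ - ⟨Z, Z⟩⟨X, Y⟩) / ⟨Z, Z⟩²`, where `Z` is the lift of `z` and `X`, `Y` are the lifts
of the tangent vectors. The Riemannian metric is its real part. -/
def metric (z ξ η : ℂ × ℂ) : ℂ :=
  4 * (herm ![ξ.1, ξ.2, 0] (lift z) * herm (lift z) ![η.1, η.2, 0]
    - herm (lift z) (lift z) * herm ![ξ.1, ξ.2, 0] ![η.1, η.2, 0]) / herm (lift z) (lift z) ^ 2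

/-- The Gram matrix of the metric with respect to the standard basis of `ℂ²`. -/
def metricGram (z : ℂ × ℂ) : Matrix (Fin 2) (Fin 2) ℂ :=
  Matrix.of fun i j => metric z (![(1, 0), (0, 1)] i) (![(1, 0), (0, 1)] j)

/-- The Riemannian volume of the complex hyperbolic plane: for the real part of a Hermitian form
the density with respect to Lebesgue measure on `ℂ² = ℝ⁴` is the determinant of the complex
Gram matrix. -/
def vol : Measure (ℂ × ℂ) :=
  ((volume : Measure (ℂ × ℂ)).restrict plane).withDensity
    fun z => ENNReal.ofReal (metricGram z).det.re

/-- The volume of the quotient `G \ B`: the supremum of the volumes of the measurable subsets of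
`B` that inject into the quotient. For a discrete group `G` and a `G`-invariant Borel set `B` it is
the volume of any measurable fundamental domain. -/
def quotientVolume (G : Subgroup SU21) (B : Set (ℂ × ℂ)) : ℝ≥0∞ :=
  ⨆ (F : Set (ℂ × ℂ)) (_ : MeasurableSet F ∧ F ⊆ B ∧
    ∀ x ∈ F, ∀ y ∈ F, ∀ g ∈ G, act g x = y → x = y), vol F

/-! ### Boundary points, horoballs, precise invariance -/

/-- A non-zero null vector: it represents a point of the boundary of the complex hyperbolic
plane. -/
def NullVec : Type := {p : Fin 3 → ℂ // p ≠ 0 ∧ herm p p = 0}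

/-- `g` fixes the boundary point represented by `p`. -/
def Fixes (g : SU21) (p : NullVec) : Prop := ∃ c : ℂ, mat g *ᵥ p.1 = c • p.1

/-- The (open) horoball based at the boundary point represented by `p`, with parameter `r`. -/
def horoball (p : NullVec) (r : ℝ) : Set (ℂ × ℂ) :=
  {z | z ∈ plane ∧ r * ‖herm (lift z) p.1‖ ^ 2 < -(herm (lift z) (lift z)).re}

/-- `B` is a horoball, based at some boundary point. -/
def IsHoroball (B : Set (ℂ × ℂ)) : Prop := ∃ (p : NullVec) (r : ℝ), 0 < r ∧ B = horoball p r

/-- `B` is precisely invariant under the subgroup `H` in `G`. -/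
def PreciselyInvariant (B : Set (ℂ × ℂ)) (H G : Subgroup SU21) : Prop :=
  (∀ g ∈ H, act g '' B = B) ∧ ∀ g ∈ G, g ∉ H → Disjoint (act g '' B) B

/-! ### Heisenberg translations -/

/-- `g` is unipotent. -/
def IsUnipotent (g : SU21) : Prop := IsNilpotent (mat g - 1)

/-- `g` acts on the boundary as a (possibly trivial) Heisenberg translation fixing the point
represented by `p`: it fixes that point, and a scalar multiple of `g` is unipotent. -/
def IsHeisenbergTranslation (p : NullVec) (g : SU21) : Prop :=
  Fixes g p ∧ ∃ c : ℂ, IsNilpotent (c • mat g - 1)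

theorem mat_mul (a b : SU21) : mat (a * b) = mat a * mat b := by
  simp only [mat, Subgroup.coe_mul, Matrix.SpecialLinearGroup.coe_mul]

theorem mat_one : mat 1 = 1 := by simp [mat]

theorem mat_det (a : SU21) : (mat a).det = 1 := a.1.2

theorem herm_mat (g : SU21) (x y : Fin 3 → ℂ) :
    herm (mat g *ᵥ x) (mat g *ᵥ y) = herm x y := g.2 x y

theorem nilpotent_of_fixed (p : NullVec) (N : Matrix (Fin 3) (Fin 3) ℂ)
    (hdet : N.det = 1) (hN : ∀ x y, herm (N *ᵥ x) (N *ᵥ y) = herm x y)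
    (hp : N *ᵥ p.1 = p.1) : IsNilpotent (N - 1) := by
  obtain ⟨p, hp0, hnull⟩ := p
  simp only at hp
  -- it suffices to triangularise
  have key : ∀ (P : Matrix (Fin 3) (Fin 3) ℂ) (a b c : ℂ), P.det ≠ 0 →
      N * P = P * !![1, a, b; 0, 1, c; 0, 0, 1] → IsNilpotent (N - 1) := by
    intro P a b c hP h
    refine ⟨3, ?_⟩
    have hu : IsUnit P.det := isUnit_iff_ne_zero.mpr hP
    have h1 : (N - 1) * P = P * !![0, a, b; 0, 0, c; 0, 0, 0] := by
      rw [sub_mul, h, one_mul]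
      ext i j
      fin_cases i <;> fin_cases j <;> simp [Matrix.mul_apply, Fin.sum_univ_three]
    have h3 : (N - 1) ^ 3 * P = 0 := by
      rw [pow_succ, pow_two, mul_assoc, h1, ← mul_assoc, mul_assoc (N - 1), h1, ← mul_assoc,
        h1, mul_assoc, mul_assoc]
      convert mul_zero P
      ext i j
      fin_cases i <;> fin_cases j <;> simp [Matrix.mul_apply, Fin.sum_univ_three]
    have := congrArg (· * P⁻¹) h3
    simpa [mul_assoc, Matrix.mul_nonsing_inv P hu] using this
  by_cases h2 : p 2 = 0
  · have h1 : p 1 = 0 := by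
      simpa [herm, h2] using hnull
    have h0 : p 0 ≠ 0 := by
      intro h0
      apply hp0
      ext i
      fin_cases i <;> simp [h0, h1, h2]
    have e0 := congrFun hp 0
    have e1 := congrFun hp 1
    have e2 := congrFun hp 2
    simp [Matrix.mulVec, dotProduct, Fin.sum_univ_three, h0, h1, h2] at e0 e1 e2
    have f1 := hN ![0, 1, 0] ![1, 0, 0]
    have f2 := hN ![0, 0, 1] ![1, 0, 0]
    simp [herm, Matrix.mulVec, dotProduct, Fin.sum_univ_three, e0, e1, e2] at f1 f2
    rw [Matrix.det_fin_three] at hdet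
    simp [e0, e1, e2, f1, f2] at hdet
    apply key 1 (N 0 1) (N 0 2) (N 1 2) (by simp)
    rw [mul_one, one_mul]
    ext i j
    fin_cases i <;> fin_cases j <;> simp [e0, e1, e2, f1, f2, hdet]
  · have hc2 : conj (p 2) ≠ 0 := by simpa using h2
    set x : Fin 3 → ℂ := ![-conj (p 1), conj (p 2), 0] with hx
    have hxp : herm x p = 0 := by simp [herm, hx]; ring
    have hwp : herm (N *ᵥ x) p = 0 := by rw [← hxp, ← hN x p, hp]
    set w := N *ᵥ x with hw
    set e : Fin 3 → ℂ := ![1, 0, 0] with he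
    have hvp : herm (N *ᵥ e) p = herm e p := by
      conv_lhs => rw [← hp]
      exact hN e p
    set v := N *ᵥ e with hv
    set P : Matrix (Fin 3) (Fin 3) ℂ := (Matrix.of ![p, x, e])ᵀ with hP
    have hPdet : P.det ≠ 0 := by
      rw [Matrix.det_fin_three]
      simp [hP, hx, he, h2]
    set b := w 2 / p 2 with hb
    set a := (w 1 - b * p 1) / conj (p 2) with ha
    set c1 := v 2 / p 2 with hc1
    set c2 := (v 1 - c1 * p 1) / conj (p 2) with hcc2
    have b2 : b * p 2 = w 2 := by rw [hb]; field_simp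
    have a2 : a * conj (p 2) = w 1 - b * p 1 := by rw [ha]; field_simp
    have b4 : c1 * p 2 = v 2 := by rw [hc1]; field_simp
    have a4 : c2 * conj (p 2) = v 1 - c1 * p 1 := by rw [hcc2]; field_simp
    simp only [herm] at hnull hwp hvp
    have w0 : w 0 = b * p 0 + a * -conj (p 1) := by
      apply mul_right_cancel₀ hc2
      linear_combination hwp - b * hnull + conj (p 1) * a2 + conj (p 0) * b2
    have v0 : v 0 = c1 * p 0 + c2 * -conj (p 1) + 1 := by
      apply mul_right_cancel₀ hc2
      simp [he] at hvp
      linear_combination hvp - c1 * hnull + conj (p 1) * a4 + conj (p 0) * b4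
    have hNP : N * P = P * !![1, b, c1; 0, a, c2; 0, 0, 1] := by
      have hcol : ∀ i j, (N * P) i j = (N *ᵥ (![p, x, e] j)) i := by
        intro i j
        simp [hP, Matrix.mul_apply, Matrix.mulVec, dotProduct]
      have hcol1 : ∀ i, (N * P) i 1 = w i := fun i => hcol i 1
      have hcol2 : ∀ i, (N * P) i 2 = v i := fun i => hcol i 2
      have hcol0 : ∀ i, (N * P) i 0 = p i := fun i => (hcol i 0).trans (congrFun hp i)
      clear_value w v
      ext i j
      fin_cases j
      · refine (hcol0 i).trans ?_
        fin_cases i <;> simp [hP, Matrix.mul_apply, Fin.sum_univ_three]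
      · refine (hcol1 i).trans ?_
        fin_cases i
        · simp [hP, Matrix.mul_apply, Fin.sum_univ_three, w0, hx]; ring
        · simp [hP, Matrix.mul_apply, Fin.sum_univ_three, hx, he]
          linear_combination -a2
        · simp [hP, Matrix.mul_apply, Fin.sum_univ_three, hx, he]
          linear_combination -b2
      · refine (hcol2 i).trans ?_
        fin_cases i
        · simp [hP, Matrix.mul_apply, Fin.sum_univ_three, v0, hx, he]; ring
        · simp [hP, Matrix.mul_apply, Fin.sum_univ_three, hx, he]
          linear_combination -a4
        · simp [hP, Matrix.mul_apply, Fin.sum_univ_three, hx, he]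
          linear_combination -b4
    have ha1 : a = 1 := by
      have h := congrArg Matrix.det hNP
      rw [Matrix.det_mul, Matrix.det_mul, hdet, one_mul] at h
      have h' : Matrix.det !![1, b, c1; 0, a, c2; 0, 0, 1] = a := by
        rw [Matrix.det_fin_three]; simp
      rw [h'] at h
      have := mul_left_cancel₀ hPdet ((mul_one P.det).trans h)
      exact this.symm
    rw [ha1] at hNP
    exact key P b c1 c2 hPdet hNP

/-- In terms of the eigenvalue at the fixed point: a Heisenberg translation has a cube root of
unity as eigenvalue, and conversely. -/
theorem isHeisenbergTranslation_iff (p : NullVec) (g : SU21) :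
    IsHeisenbergTranslation p g ↔ ∃ c : ℂ, c ^ 3 = 1 ∧ mat g *ᵥ p.1 = c • p.1 := by
  constructor
  · rintro ⟨⟨c, hc⟩, d, hd⟩
    refine ⟨c, ?_, hc⟩
    have hdc : d * c = 1 := by
      obtain ⟨k, hk⟩ := hd
      have h1 : (d • mat g - 1) *ᵥ p.1 = (d * c - 1) • p.1 := by
        rw [Matrix.sub_mulVec, Matrix.smul_mulVec, hc, one_mulVec, smul_smul, sub_smul, one_smul]
      have h2 : ∀ n, ((d • mat g - 1) ^ n) *ᵥ p.1 = (d * c - 1) ^ n • p.1 := by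
        intro n
        induction n with
        | zero => simp
        | succ n ih =>
          rw [pow_succ, ← Matrix.mulVec_mulVec, h1, Matrix.mulVec_smul, ih, smul_smul, pow_succ,
            mul_comm]
      have h3 := h2 k
      rw [hk, Matrix.zero_mulVec] at h3
      have h4 := (smul_eq_zero.mp h3.symm).resolve_right p.2.1
      exact sub_eq_zero.mp (eq_zero_of_pow_eq_zero h4)
    have hdet : (d • mat g).det = 1 := by
      have h1 := (Matrix.isNilpotent_charpoly_sub_pow_of_isNilpotent hd).eq_zero
      have h2 : (d • mat g - 1).charpoly = Polynomial.X ^ 3 := by simpa using sub_eq_zero.mp h1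
      have h3 := congrArg (Polynomial.eval (-1)) h2
      rw [Matrix.eval_charpoly] at h3
      have h4 : Matrix.scalar (Fin 3) (-1 : ℂ) - (d • mat g - 1) = -(d • mat g) := by
        rw [map_neg, map_one]; abel
      rw [h4, Matrix.det_neg] at h3
      simpa [pow_succ] using h3
    rw [Matrix.det_smul, mat_det] at hdet
    have : (d * c) ^ 3 = 1 := by rw [hdc, one_pow]
    simp at hdet
    rw [mul_pow, hdet, one_mul] at this
    exact this
  · rintro ⟨c, h3, hc⟩
    have hc0 : c ≠ 0 := by rintro rfl; simp at h3
    have hn : c * conj c = 1 := by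
      have : ‖c‖ = 1 := Complex.norm_eq_one_of_pow_eq_one h3 (by norm_num)
      rw [Complex.mul_conj, Complex.normSq_eq_norm_sq, this]; simp
    have hi : c⁻¹ = conj c := by field_simp; exact hn.symm
    refine ⟨⟨c, hc⟩, c⁻¹, nilpotent_of_fixed p _ ?_ ?_ ?_⟩
    · rw [Matrix.det_smul, mat_det]; simp [h3]
    · intro x y
      have : ∀ u v : Fin 3 → ℂ, herm (c⁻¹ • u) (c⁻¹ • v) = herm u v := by
        intro u v
        simp only [herm, Pi.smul_apply, smul_eq_mul, map_mul, hi, Complex.conj_conj]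
        linear_combination (u 0 * conj (v 2) + u 1 * conj (v 1) + u 2 * conj (v 0)) * hn
      rw [Matrix.smul_mulVec, Matrix.smul_mulVec, this, herm_mat]
    · rw [Matrix.smul_mulVec, hc, smul_smul, inv_mul_cancel₀ hc0, one_smul]

/-- The Heisenberg group at the boundary point represented by `p`: all elements of `SU(2,1)` that
act as Heisenberg translations fixing that point. -/
def heisenberg (p : NullVec) : Subgroup SU21 where
  carrier := {g | IsHeisenbergTranslation p g}
  one_mem' := ⟨⟨1, by simp [mat_one]⟩, 1, by simp [mat_one]⟩
  mul_mem' := by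
    intro a b ha hb
    rw [Set.mem_ofPred_eq, isHeisenbergTranslation_iff] at *
    obtain ⟨c, hc, hc'⟩ := ha
    obtain ⟨d, hd, hd'⟩ := hb
    refine ⟨c * d, by rw [mul_pow, hc, hd, one_mul], ?_⟩
    rw [mat_mul, ← Matrix.mulVec_mulVec, hd', Matrix.mulVec_smul, hc', smul_smul, mul_comm]
  inv_mem' := by
    intro a ha
    rw [Set.mem_ofPred_eq, isHeisenbergTranslation_iff] at *
    obtain ⟨c, hc, hc'⟩ := ha
    have hc0 : c ≠ 0 := by rintro rfl; simp at hc
    refine ⟨c⁻¹, by rw [inv_pow, hc, inv_one], ?_⟩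
    have h : mat a⁻¹ *ᵥ (mat a *ᵥ p.1) = p.1 := by
      rw [Matrix.mulVec_mulVec, ← mat_mul]; simp [mat_one]
    rw [hc', Matrix.mulVec_smul] at h
    rw [← h, smul_smul, inv_mul_cancel₀ hc0, one_smul, h]

/-- `T` is unipotent and generates the centre of `H` up to scalar matrices, i.e. the image of `T` in
`PU(2,1)` generates the image of the centre of `H`. -/
def GeneratesCenter (T : SU21) (H : Subgroup SU21) : Prop :=
  IsUnipotent T ∧
    (Subgroup.center H).map H.subtype ⊔ scalars = Subgroup.zpowers T ⊔ scalars

end CHyp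

end

/-! Move `p` to infinity in the Siegel domain and set `height z = -⟨Z, Z⟩` for the standard lift
`Z`. Horoballs at infinity are then `{height > R}`, and the volume is `16 / height ^ 3` times
Lebesgue measure. A Heisenberg translation acts by `(z₁, z₂) ↦ (z₁ - τ̄ z₂ + x, z₂ + τ)`. The matrix
`T` is vertical: `τ = 0` and `x = i s` with `s` real and non-zero.

Let `c` be the lower left entry of `C`. Since `T - 1` has the single entry `x`, in the corner, the
trace of `T C T C⁻¹` is `3 - s² |c|²` (`trace_conj_heis`). If the horoball of height `R` is disjoint
from its image under `C`, then `R |c| ≥ 2`: otherwise a point above `C⁻¹(∞)` would stay in the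
horoball (`two_le_of_disjoint`).

For the volume, let `a`, `b` have commutator `T ^ q` and horizontal parts `τ`, `τ'`. The commutator
formula gives `q |s| = 2 |Im (τ̄ τ')|`, so the parallelogram on `τ`, `τ'` has area `q |s| / 2`. The
part of the horoball over this parallelogram and a vertical interval of length `|s|` has volume at
most `(4 / R²) |s| (q |s| / 2) = 2 q s² / R²` (`vol_box_le`). The products `a^i b^j t^k`, where `t`
is `T` up to a scalar, bring every point of the horoball into this box. They lie in the translation
subgroup, so representatives of its `m` cosets allow `m` copies of any set injecting into the
quotient to be cut up and packed into the box (`packing`, `vol_le_of_commutator`). Hence the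
quotient volume is at most `2 q s² / (R² m)`, and `4 ≤ R² |c|²` turns this into `q s² |c|² / (2 m)`,
the asserted bound. -/

noncomputable section

namespace CHyp

/-! ### The action on the plane -/

/-- The last coordinate of the image of the standard lift. -/
def den (g : SU21) (z : ℂ × ℂ) : ℂ := (mat g *ᵥ lift z) 2

/-- The negative of the Hermitian square of the standard lift. -/
def height (z : ℂ × ℂ) : ℝ := -(herm (lift z) (lift z)).re

theorem height_eq (z : ℂ × ℂ) : height z = -(2 * z.1.re + Complex.normSq z.2) := by
  simp [height, herm, lift, Complex.normSq_apply]; ring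

theorem mem_plane_iff (z : ℂ × ℂ) : z ∈ plane ↔ 0 < height z := by
  simp [plane, height]

theorem herm_self_im (x : Fin 3 → ℂ) : (herm x x).im = 0 := by
  simp [herm]; ring

theorem herm_lift_self (z : ℂ × ℂ) : herm (lift z) (lift z) = -(height z : ℂ) := by
  apply Complex.ext
  · simp [height]
  · simp [herm_self_im]

theorem herm_smul (c : ℂ) (x : Fin 3 → ℂ) :
    herm (c • x) (c • x) = (Complex.normSq c : ℂ) * herm x x := by
  rw [← Complex.mul_conj]
  simp [herm]; ring

/-- A vector with vanishing last coordinate has Hermitian square `|x₁|² ≥ 0`, so it cannot be the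
image of a negative vector. -/
theorem den_ne_zero (g : SU21) {z : ℂ × ℂ} (hz : z ∈ plane) : den g z ≠ 0 := by
  intro h
  have h1 := herm_mat g (lift z) (lift z)
  have h2 : (herm (mat g *ᵥ lift z) (mat g *ᵥ lift z)).re < 0 := by rw [h1]; exact hz
  have h3 : (mat g *ᵥ lift z) 2 = 0 := h
  simp only [herm, h3] at h2
  simp at h2
  nlinarith [sq_nonneg ((mat g *ᵥ lift z) 1).re, sq_nonneg ((mat g *ᵥ lift z) 1).im]

theorem lift_act (g : SU21) {z : ℂ × ℂ} (h : den g z ≠ 0) :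
    mat g *ᵥ lift z = den g z • lift (act g z) := by
  ext i
  fin_cases i
  · exact (mul_div_cancel₀ _ h).symm
  · exact (mul_div_cancel₀ _ h).symm
  · simp [den, lift]

/-- The form is preserved, so renormalising the image of the lift to last coordinate `1` is all that
changes the height. -/
theorem height_act_mul (g : SU21) {z : ℂ × ℂ} (h : den g z ≠ 0) :
    Complex.normSq (den g z) * height (act g z) = height z := by
  have h1 := herm_mat g (lift z) (lift z)
  rw [lift_act g h, herm_smul] at h1
  have h2 := congrArg Complex.re h1
  rw [Complex.re_ofReal_mul] at h2
  simp only [height]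
  linarith

theorem act_mem_plane (g : SU21) {z : ℂ × ℂ} (hz : z ∈ plane) : act g z ∈ plane := by
  have h := height_act_mul g (den_ne_zero g hz)
  rw [mem_plane_iff] at *
  rw [← h] at hz
  exact pos_of_mul_pos_right hz (Complex.normSq_nonneg _)

theorem act_eq_of_smul (g : SU21) (z w : ℂ × ℂ) (c : ℂ) (hc : c ≠ 0)
    (h : mat g *ᵥ lift z = c • lift w) : act g z = w := by
  simp only [act, h]
  ext <;> simp [lift, hc]

theorem act_mul (g h : SU21) {z : ℂ × ℂ} (hz : z ∈ plane) :
    act (g * h) z = act g (act h z) := by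
  have h1 := den_ne_zero h hz
  have h2 := den_ne_zero g (act_mem_plane h hz)
  refine act_eq_of_smul _ _ _ (den h z * den g (act h z)) (mul_ne_zero h1 h2) ?_
  rw [mat_mul, ← mulVec_mulVec, lift_act h h1, mulVec_smul, lift_act g h2, smul_smul]

theorem act_one (z : ℂ × ℂ) : act 1 z = z :=
  act_eq_of_smul _ _ _ 1 one_ne_zero (by simp [mat_one])

theorem act_inv_act (g : SU21) {z : ℂ × ℂ} (hz : z ∈ plane) : act g⁻¹ (act g z) = z := by
  rw [← act_mul _ _ hz, inv_mul_cancel, act_one]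

theorem act_act_inv (g : SU21) {z : ℂ × ℂ} (hz : z ∈ plane) : act g (act g⁻¹ z) = z := by
  rw [← act_mul _ _ hz, mul_inv_cancel, act_one]

theorem injOn_act (g : SU21) : Set.InjOn (act g) plane := fun x hx y hy h => by
  rw [← act_inv_act g hx, h, act_inv_act g hy]

theorem image_act_subset (g : SU21) {F : Set (ℂ × ℂ)} (hF : F ⊆ plane) : act g '' F ⊆ plane := by
  rintro _ ⟨x, hx, rfl⟩
  exact act_mem_plane g (hF hx)

theorem image_act_eq (g : SU21) {F : Set (ℂ × ℂ)} (hF : F ⊆ plane) :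
    act g '' F = plane ∩ act g⁻¹ ⁻¹' F := by
  ext z
  constructor
  · rintro ⟨x, hx, rfl⟩
    refine ⟨act_mem_plane g (hF hx), ?_⟩
    rw [Set.mem_preimage, act_inv_act g (hF hx)]
    exact hx
  · rintro ⟨hz, hx⟩
    exact ⟨_, hx, act_act_inv g hz⟩

theorem image_act_mul (g h : SU21) {F : Set (ℂ × ℂ)} (hF : F ⊆ plane) :
    act (g * h) '' F = act g '' (act h '' F) := by
  rw [Set.image_image]
  exact Set.image_congr fun z hz => act_mul g h (hF hz)

theorem continuous_lift : Continuous lift := by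
  refine continuous_pi fun i => ?_
  fin_cases i
  · exact continuous_fst
  · exact continuous_snd
  · exact continuous_const

theorem continuous_mulVec_lift (g : SU21) (i : Fin 3) :
    Continuous fun z => (mat g *ᵥ lift z) i :=
  (continuous_apply i).comp (continuous_const.matrix_mulVec continuous_lift)

theorem measurable_act (g : SU21) : Measurable (act g) :=
  ((continuous_mulVec_lift g 0).measurable.div (continuous_mulVec_lift g 2).measurable).prodMk
    ((continuous_mulVec_lift g 1).measurable.div (continuous_mulVec_lift g 2).measurable)

theorem continuous_height : Continuous height := by
  have : height = fun z : ℂ × ℂ => -(2 * z.1.re + Complex.normSq z.2) := funext height_eq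
  rw [this]
  fun_prop

theorem measurableSet_plane : MeasurableSet plane := by
  have : plane = height ⁻¹' Set.Ioi 0 := by ext z; simp [mem_plane_iff]
  rw [this]
  exact continuous_height.measurable measurableSet_Ioi

theorem measurableSet_image_act (g : SU21) {F : Set (ℂ × ℂ)} (hF : F ⊆ plane)
    (hm : MeasurableSet F) : MeasurableSet (act g '' F) := by
  rw [image_act_eq g hF]
  exact measurableSet_plane.inter (measurable_act _ hm)

/-! ### The volume -/

theorem metricGram_det (z : ℂ × ℂ) (hz : z ∈ plane) :
    (metricGram z).det.re = 16 / height z ^ 3 := by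
  have h0 : (height z : ℂ) ≠ 0 := by
    have := (mem_plane_iff z).1 hz
    exact_mod_cast this.ne'
  have hN : z.1 + z.2 * conj z.2 + conj z.1 = -(height z : ℂ) := by
    rw [← herm_lift_self]; simp [herm, lift]
  have : (metricGram z).det = ((16 / height z ^ 3 : ℝ) : ℂ) := by
    rw [det_fin_two]
    simp only [metricGram, metric, of_apply, herm_lift_self]
    simp [herm, lift]
    field_simp
    ring
  rw [this, Complex.ofReal_re]

theorem vol_eq_lintegral {F : Set (ℂ × ℂ)} (hm : MeasurableSet F) (hF : F ⊆ plane) :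
    vol F = ∫⁻ z in F, ENNReal.ofReal (16 / height z ^ 3) := by
  rw [vol, withDensity_apply _ hm, Measure.restrict_restrict hm, Set.inter_eq_left.2 hF]
  exact setLIntegral_congr_fun hm fun z hz => by rw [metricGram_det z (hF hz)]

theorem vol_eq_zero_of_volume_eq_zero {F : Set (ℂ × ℂ)} (h : (volume : Measure (ℂ × ℂ)) F = 0) :
    vol F = 0 := by
  have h1 : vol ≪ (volume : Measure (ℂ × ℂ)).restrict plane := withDensity_absolutelyContinuous _ _
  exact h1 (Measure.absolutelyContinuous_restrict h)

/-- The complex derivative of the action. -/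
def derivMat (g : SU21) (z : ℂ × ℂ) : Matrix (Fin 2) (Fin 2) ℂ :=
  Matrix.of fun i j =>
    (mat g (![0, 1] i) (![0, 1] j) * den g z
      - (mat g *ᵥ lift z) (![0, 1] i) * mat g 2 (![0, 1] j)) / den g z ^ 2

/-- After clearing denominators, the numerator is `den g z` times the determinant of `g`, which is
one. -/
theorem derivMat_det (g : SU21) (z : ℂ × ℂ) (h : den g z ≠ 0) :
    (derivMat g z).det = 1 / den g z ^ 3 := by
  have h1 := mat_det g
  rw [det_fin_three] at h1
  rw [det_fin_two]
  simp only [derivMat, of_apply]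
  simp
  field_simp
  simp only [den, mulVec, dotProduct, Fin.sum_univ_three, lift]
  simp
  linear_combination (mat g 2 0 * z.1 + mat g 2 1 * z.2 + mat g 2 2) * h1

/-- The complex derivative of the action, as a continuous linear map. -/
def derivMap (g : SU21) (z : ℂ × ℂ) : ℂ × ℂ →L[ℂ] ℂ × ℂ :=
  LinearMap.toContinuousLinearMap
    (toLin (Module.Basis.finTwoProd ℂ) (Module.Basis.finTwoProd ℂ) (derivMat g z))

theorem hasFDerivAt_mulVec_lift (g : SU21) (i : Fin 3) (z : ℂ × ℂ) :
    HasFDerivAt (fun z => (mat g *ᵥ lift z) i)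
      (mat g i 0 • ContinuousLinearMap.fst ℂ ℂ ℂ + mat g i 1 • ContinuousLinearMap.snd ℂ ℂ ℂ) z := by
  have : (fun z => (mat g *ᵥ lift z) i)
      = fun z : ℂ × ℂ => mat g i 0 * z.1 + mat g i 1 * z.2 + mat g i 2 := by
    ext z
    simp [mulVec, dotProduct, Fin.sum_univ_three, lift]
  rw [this]
  exact ((hasFDerivAt_fst.const_mul _).add (hasFDerivAt_snd.const_mul _)).add_const _

theorem hasFDerivAt_act (g : SU21) (z : ℂ × ℂ) (h : den g z ≠ 0) :
    HasFDerivAt (act g) (derivMap g z) z := by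
  have hi := (hasDerivAt_inv h).comp_hasFDerivAt z (hasFDerivAt_mulVec_lift g 2 z)
  refine (((hasFDerivAt_mulVec_lift g 0 z).mul hi).prodMk
    ((hasFDerivAt_mulVec_lift g 1 z).mul hi)).congr_fderiv ?_
  have e : derivMat g z = !![derivMat g z 0 0, derivMat g z 0 1;
      derivMat g z 1 0, derivMat g z 1 1] := eta_fin_two _
  ext <;> rw [derivMap, e] <;>
    simp [toLin_finTwoProd_apply] <;>
    simp [derivMat, den] <;> rw [den] at h <;> field_simp <;> ring

theorem det_derivMap (g : SU21) (z : ℂ × ℂ) (h : den g z ≠ 0) :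
    ((derivMap g z).restrictScalars ℝ).det = 1 / Complex.normSq (den g z) ^ 3 := by
  have h1 : LinearMap.det (derivMap g z : ℂ × ℂ →ₗ[ℂ] ℂ × ℂ) = 1 / den g z ^ 3 := by
    rw [← derivMat_det g z h, derivMap]
    simp
  have h2 := LinearMap.det_restrictScalars (R := ℝ) (f := (derivMap g z : ℂ × ℂ →ₗ[ℂ] ℂ × ℂ))
  rw [h1, Algebra.norm_complex_apply] at h2
  simpa [ContinuousLinearMap.det] using h2

instance : Measure.IsAddHaarMeasure (volume : Measure (ℂ × ℂ)) :=
  Measure.prod.instIsAddHaarMeasure _ _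

/-- The real Jacobian is the squared modulus `|den|⁻⁶` of the complex one, and it cancels the factor
by which `height ^ 3` changes. -/
theorem vol_image_act (g : SU21) {F : Set (ℂ × ℂ)} (hF : F ⊆ plane) (hm : MeasurableSet F) :
    vol (act g '' F) = vol F := by
  rw [vol_eq_lintegral (measurableSet_image_act g hF hm) (image_act_subset g hF),
    vol_eq_lintegral hm hF,
    lintegral_image_eq_lintegral_abs_det_fderiv_mul volume hm
      (fun z hz => ((hasFDerivAt_act g z
        (den_ne_zero g (hF hz))).restrictScalars ℝ).hasFDerivWithinAt)
      ((injOn_act g).mono hF)]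
  refine setLIntegral_congr_fun hm fun z hz => ?_
  have h := den_ne_zero g (hF hz)
  have hn : 0 < Complex.normSq (den g z) := Complex.normSq_pos.2 h
  have hu := (mem_plane_iff _).1 (act_mem_plane g (hF hz))
  simp only [det_derivMap g z h]
  rw [abs_of_pos (by positivity), ← ENNReal.ofReal_mul (by positivity), ← height_act_mul g h]
  congr 1
  field_simp

/-! ### The stabiliser of the point at infinity -/

/-- The boundary point at infinity. -/
def infPt : NullVec := ⟨![1, 0, 0], by
  refine ⟨fun h => ?_, by simp [herm]⟩
  simpa using congrFun h 0⟩

/-- The matrix of a Heisenberg translation at infinity. -/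
def heisMat (τ x : ℂ) : Matrix (Fin 3) (Fin 3) ℂ := !![1, -conj τ, x; 0, 1, τ; 0, 0, 1]

/-- `g` is a scalar multiple of the Heisenberg translation with parameters `τ`, `x`. -/
def HeisTrans (g : SU21) (τ x : ℂ) : Prop := ∃ ω : ℂ, ω ≠ 0 ∧ mat g = ω • heisMat τ x

/-- The twist `-τ̄ τ'` is the source of all commutators: exchanging the factors changes the vertical
part by twice the imaginary part of `τ̄ τ'`. -/
theorem heisMat_mul (τ x τ' x' : ℂ) :
    heisMat τ x * heisMat τ' x' = heisMat (τ + τ') (x + x' - conj τ * τ') := by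
  ext i j
  fin_cases i <;> fin_cases j <;> simp [heisMat, Matrix.mul_apply, Fin.sum_univ_three] <;> ring

theorem heisMat_zero : heisMat 0 0 = 1 := by
  ext i j
  fin_cases i <;> fin_cases j <;> simp [heisMat]

theorem HeisTrans.mul {g h : SU21} {τ x τ' x' : ℂ} (hg : HeisTrans g τ x)
    (hh : HeisTrans h τ' x') : HeisTrans (g * h) (τ + τ') (x + x' - conj τ * τ') := by
  obtain ⟨ω, h0, h1⟩ := hg
  obtain ⟨ω', h0', h1'⟩ := hh
  refine ⟨ω * ω', mul_ne_zero h0 h0', ?_⟩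
  rw [mat_mul, h1, h1', smul_mul_smul_comm, heisMat_mul]

theorem mat_mul_inv (g : SU21) : mat g * mat g⁻¹ = 1 := by
  rw [← mat_mul, mul_inv_cancel, mat_one]

theorem mat_inv_mul (g : SU21) : mat g⁻¹ * mat g = 1 := by
  rw [← mat_mul, inv_mul_cancel, mat_one]

theorem mat_injective : Function.Injective mat := fun _ _ h => Subtype.ext (Subtype.ext h)

theorem HeisTrans.inv {g : SU21} {τ x : ℂ} (hg : HeisTrans g τ x) :
    HeisTrans g⁻¹ (-τ) (-x - conj τ * τ) := by
  obtain ⟨ω, h0, h1⟩ := hg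
  refine ⟨ω⁻¹, inv_ne_zero h0, ?_⟩
  have h2 : mat g * (ω⁻¹ • heisMat (-τ) (-x - conj τ * τ)) = 1 := by
    rw [h1, smul_mul_smul_comm, heisMat_mul, mul_inv_cancel₀ h0, one_smul, ← heisMat_zero]
    congr 1 <;> ring
  rw [← one_mul (_ • _), ← mat_inv_mul g, mul_assoc, h2, mul_one]

theorem HeisTrans.one : HeisTrans 1 0 0 := ⟨1, one_ne_zero, by rw [heisMat_zero, mat_one, one_smul]⟩

theorem HeisTrans.zpow {g : SU21} {τ x : ℂ} (hg : HeisTrans g τ x) (n : ℤ) :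
    ∃ y, HeisTrans (g ^ n) (n * τ) y ∧ (τ = 0 → y = n * x) := by
  induction n with
  | zero => exact ⟨0, by simpa using HeisTrans.one, by simp⟩
  | succ n ih =>
    obtain ⟨y, h1, h2⟩ := ih
    refine ⟨y + x - conj ((n : ℤ) * τ) * τ, ?_, ?_⟩
    · rw [_root_.zpow_add_one, Int.cast_add, Int.cast_one, add_mul, one_mul]
      exact h1.mul hg
    · intro h
      simp [h2 h, h]; ring
  | pred n ih =>
    obtain ⟨y, h1, h2⟩ := ih
    refine ⟨y + (-x - conj τ * τ) - conj ((-n : ℤ) * τ) * (-τ), ?_, ?_⟩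
    · rw [_root_.zpow_sub_one, Int.cast_sub, Int.cast_one, sub_mul, one_mul, sub_eq_add_neg]
      exact h1.mul hg.inv
    · intro h
      simp [h2 h, h]; ring

theorem HeisTrans.unique {g : SU21} {τ x τ' x' : ℂ} (hg : HeisTrans g τ x)
    (hg' : HeisTrans g τ' x') : τ = τ' ∧ x = x' := by
  obtain ⟨ω, h0, h1⟩ := hg
  obtain ⟨ω', h0', h1'⟩ := hg'
  rw [h1] at h1'
  have e : ω = ω' := by simpa [heisMat] using congrFun (congrFun h1' 0) 0
  subst e
  constructor
  · simpa [heisMat, h0] using congrFun (congrFun h1' 1) 2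
  · simpa [heisMat, h0] using congrFun (congrFun h1' 0) 2

theorem HeisTrans.mul_scalar {g σ : SU21} {τ x : ℂ} (hg : HeisTrans g τ x) (hσ : σ ∈ scalars) :
    HeisTrans (g * σ) τ x := by
  obtain ⟨c, hc⟩ := hσ
  have h0 : c ≠ 0 := by
    rintro rfl
    have := mat_det σ
    simp [hc] at this
  simpa using hg.mul (τ' := 0) (x' := 0) ⟨c, h0, by rw [heisMat_zero]; exact hc⟩

theorem HeisTrans.act_eq {g : SU21} {τ x : ℂ} (hg : HeisTrans g τ x) (z : ℂ × ℂ) :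
    act g z = (z.1 - conj τ * z.2 + x, z.2 + τ) := by
  obtain ⟨ω, h0, h1⟩ := hg
  refine act_eq_of_smul _ _ _ ω h0 ?_
  rw [h1, smul_mulVec]
  congr 1
  ext i
  fin_cases i <;> simp [heisMat, lift, mulVec, dotProduct, Fin.sum_univ_three]
  ring

/-- Invariance of the form on pairs of basis vectors makes the stabiliser of infinity upper
triangular. -/
theorem fixes_infPt {g : SU21} (h : Fixes g infPt) :
    mat g 1 0 = 0 ∧ mat g 2 0 = 0 ∧ mat g 2 1 = 0 ∧ mat g 0 0 * conj (mat g 2 2) = 1 ∧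
      mat g 1 1 * conj (mat g 1 1) = 1 ∧
      mat g 1 2 * conj (mat g 1 1) + mat g 2 2 * conj (mat g 0 1) = 0 ∧
      mat g 0 2 * conj (mat g 2 2) + mat g 1 2 * conj (mat g 1 2)
        + mat g 2 2 * conj (mat g 0 2) = 0 := by
  obtain ⟨c, hc⟩ := h
  have e1 := congrFun hc 1
  have e2 := congrFun hc 2
  simp [infPt, mulVec, dotProduct, Fin.sum_univ_three] at e1 e2
  have f0 := herm_mat g ![1, 0, 0] ![0, 0, 1]
  have f1 := herm_mat g ![1, 0, 0] ![0, 1, 0]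
  have f2 := herm_mat g ![0, 1, 0] ![0, 1, 0]
  have f3 := herm_mat g ![0, 0, 1] ![0, 1, 0]
  have f4 := herm_mat g ![0, 0, 1] ![0, 0, 1]
  simp [herm, mulVec, dotProduct, Fin.sum_univ_three, e1, e2] at f0 f1 f2 f3 f4
  have h00 : mat g 0 0 ≠ 0 := by intro h; simp [h] at f0
  have h21 := f1.resolve_left h00
  simp [h21] at f2 f3
  exact ⟨e1, e2, h21, f0, f2, f3, f4⟩

/-- The eigenvalue `c` at infinity is a cube root of unity. The form then forces the last diagonal
entry to be `c`, and determinant one forces the middle one. -/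
theorem exists_heisTrans {g : SU21} (h : IsHeisenbergTranslation infPt g) :
    ∃ τ x, HeisTrans g τ x := by
  obtain ⟨c, h3, hc⟩ := (isHeisenbergTranslation_iff _ _).1 h
  obtain ⟨h10, h20, h21, h00, h11, h12, -⟩ := fixes_infPt h.1
  have c0 : c ≠ 0 := by rintro rfl; simp at h3
  have hn : c * conj c = 1 := by
    have : ‖c‖ = 1 := Complex.norm_eq_one_of_pow_eq_one h3 (by norm_num)
    rw [Complex.mul_conj, Complex.normSq_eq_norm_sq, this]; simp
  have hcc : conj c ≠ 0 := by simpa using c0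
  have g0 : mat g 0 0 = c := by
    simpa [infPt, mulVec, dotProduct, Fin.sum_univ_three] using congrFun hc 0
  have g2 : mat g 2 2 = c := by
    rw [g0] at h00
    have := congrArg conj (mul_left_cancel₀ c0 (h00.trans hn.symm))
    simpa using this
  have g1 : mat g 1 1 = c := by
    have hd := mat_det g
    rw [det_fin_three] at hd
    simp only [h10, h20, h21, g0, g2] at hd
    have : c * c * mat g 1 1 = c * c * c := by linear_combination hd - h3
    exact mul_left_cancel₀ (mul_ne_zero c0 c0) this
  rw [g1, g2] at h12
  refine ⟨mat g 1 2 / c, mat g 0 2 / c, c, c0, ?_⟩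
  have h01 : mat g 0 1 = -(c * (conj (mat g 1 2) / conj c)) := by
    have := congrArg conj h12
    simp at this
    field_simp
    linear_combination this
  ext i j
  fin_cases i <;> fin_cases j <;> simp [heisMat, h10, h20, h21, g0, g1, g2, h01] <;> field_simp

theorem heisTrans_re {g : SU21} {x : ℂ} (h : HeisTrans g 0 x) : x.re = 0 := by
  obtain ⟨ω, h0, h1⟩ := h
  have f := herm_mat g ![0, 0, 1] ![0, 0, 1]
  simp [h1, herm, heisMat, mulVec, dotProduct, Fin.sum_univ_three] at f
  have : ω * conj ω * (x + conj x) = 0 := by linear_combination f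
  simp only [mul_eq_zero, h0, map_eq_zero, false_or] at this
  have := congrArg Complex.re this
  simp at this
  linarith

/-- A Heisenberg translation of trace `3` has no scalar factor. -/
theorem heisMat_of_trace {g : SU21} (hg : IsHeisenbergTranslation infPt g)
    (ht : (mat g).trace = 3) : ∃ τ x, mat g = heisMat τ x := by
  obtain ⟨τ, x, ω, h0, h1⟩ := exists_heisTrans hg
  refine ⟨τ, x, ?_⟩
  rw [h1] at ht ⊢
  have : ω = 1 := by
    simp [heisMat, trace_fin_three] at ht
    linear_combination ht / 3
  rw [this, one_smul]

/-- The inverse is the adjoint for the antidiagonal form. -/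
theorem mat_inv_apply (g : SU21) (i j : Fin 3) :
    mat g⁻¹ i j = conj (mat g j.rev i.rev) := by
  have h : ∀ x y, herm (mat g⁻¹ *ᵥ x) y = herm x (mat g *ᵥ y) := by
    intro x y
    rw [← herm_mat g, mulVec_mulVec, mat_mul_inv, one_mulVec]
  have := h (Pi.single j 1) (Pi.single i.rev 1)
  simp only [mulVec_single_one] at this
  fin_cases i <;> fin_cases j <;> simpa [herm, Fin.rev, Fin.isValue, Pi.single_apply] using this

/-- Write `T = 1 + N`. The terms linear in `N` are traceless, and the quadratic one sees only the
lower left entries of `C` and `C⁻¹`, which are conjugate. -/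
theorem trace_conj_heis {T C : SU21} {x : ℂ} (hT : mat T = heisMat 0 x) :
    (mat (T * C * T * C⁻¹)).trace = 3 + x ^ 2 * (mat C 2 0 * conj (mat C 2 0)) := by
  set N : Matrix (Fin 3) (Fin 3) ℂ := heisMat 0 x - 1 with hN
  have hT' : mat T = 1 + N := by rw [hT, hN]; abel
  have e : mat (T * C * T * C⁻¹) = 1 + mat C * N * mat C⁻¹ + N + N * mat C * N * mat C⁻¹ := by
    rw [mat_mul, mat_mul, mat_mul, hT']
    calc (1 + N) * mat C * (1 + N) * mat C⁻¹
        = mat C * mat C⁻¹ + mat C * N * mat C⁻¹ + N * (mat C * mat C⁻¹)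
          + N * mat C * N * mat C⁻¹ := by noncomm_ring
      _ = _ := by rw [mat_mul_inv, mul_one]
  have h0 : N.trace = 0 := by simp [hN, heisMat, trace_fin_three]; norm_num
  have h1 : (mat C * N * mat C⁻¹).trace = 0 := by
    rw [trace_mul_comm, ← mul_assoc, mat_inv_mul, one_mul, h0]
  have hNe : ∀ i j, N i j = if i = 0 ∧ j = 2 then x else 0 := by
    intro i j
    rw [hN]
    fin_cases i <;> fin_cases j <;> simp [heisMat]
  have h2 : (N * mat C * N * mat C⁻¹).trace = x ^ 2 * (mat C 2 0 * mat C⁻¹ 2 0) := by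
    simp [trace_fin_three, Matrix.mul_apply, Fin.sum_univ_three, hNe]
    ring
  rw [e, trace_add, trace_add, trace_add, h0, h1, h2, mat_inv_apply]
  simp [Fin.rev]

/-! ### Horoballs at infinity -/

/-- The horoball of height `R` at infinity. -/
def hball (R : ℝ) : Set (ℂ × ℂ) := {z | R < height z}

theorem hball_subset_plane {R : ℝ} (hR : 0 ≤ R) : hball R ⊆ plane := fun z hz =>
  (mem_plane_iff z).2 (hR.trans_lt hz)

theorem measurableSet_hball (R : ℝ) : MeasurableSet (hball R) :=
  continuous_height.measurable measurableSet_Ioi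

theorem horoball_eq_hball (p : NullVec) (r : ℝ) (hr : 0 < r) (h1 : p.1 1 = 0) (h2 : p.1 2 = 0) :
    ∃ R, 0 < R ∧ horoball p r = hball R := by
  have h0 : p.1 0 ≠ 0 := by
    intro h0
    apply p.2.1
    ext i
    fin_cases i <;> simp [h0, h1, h2]
  have hR : 0 < r * ‖p.1 0‖ ^ 2 := by positivity
  refine ⟨_, hR, ?_⟩
  ext z
  have e : herm (lift z) p.1 = conj (p.1 0) := by simp [herm, lift, h1, h2]
  simp only [horoball, hball, Set.mem_ofPred_eq, mem_plane_iff, e, RCLike.norm_conj]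
  change 0 < height z ∧ _ < height z ↔ _
  exact ⟨fun h => h.2, fun h => ⟨hR.trans h, h⟩⟩

theorem den_eq (g : SU21) (z : ℂ × ℂ) :
    den g z = mat g 2 0 * z.1 + mat g 2 1 * z.2 + mat g 2 2 := by
  simp [den, mulVec, dotProduct, Fin.sum_univ_three, lift]

/-- The horoball at infinity meets its image under `C` unless it is small. -/
theorem two_le_of_disjoint {R : ℝ} (hR : 0 < R) (C : SU21)
    (h : Disjoint (act C '' hball R) (hball R)) : 2 ≤ R * ‖mat C 2 0‖ := by
  have key : ∀ z, R < height z → R < height (act C z) → False := fun z h1 h2 =>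
    Set.disjoint_left.1 h ⟨z, h1, rfl⟩ h2
  by_cases hc : mat C 2 0 = 0
  · exfalso
    have f0 := herm_mat C ![1, 0, 0] ![1, 0, 0]
    simp [herm, mulVec, dotProduct, Fin.sum_univ_three, hc] at f0
    obtain ⟨-, -, h21, h00, -⟩ := fixes_infPt (g := C) ⟨mat C 0 0, by
      ext i
      fin_cases i <;> simp [infPt, mulVec, dotProduct, Fin.sum_univ_three, hc, f0]⟩
    have h22 : mat C 2 2 ≠ 0 := by intro h; simp [h] at h00
    have hn : 0 < Complex.normSq (mat C 2 2) := Complex.normSq_pos.2 h22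
    set n := Complex.normSq (mat C 2 2) with hnd
    -- Here `C` fixes infinity and divides heights by `n`; a point of height `R + R n + 2` lies in
    -- the horoball and so does its image.
    set z : ℂ × ℂ := (((-(R + R * n) / 2 - 1 : ℝ) : ℂ), 0) with hz
    have hd : den C z = mat C 2 2 := by rw [den_eq, hc, h21]; ring
    have hh : height z = R + R * n + 2 := by rw [height_eq]; simp [hz]; ring
    have h3 := height_act_mul C (z := z) (by rwa [hd])
    rw [hd, hh] at h3
    have : 0 < R * n := by positivity
    refine key z (by rw [hh]; linarith) ?_
    rw [← hnd] at h3
    by_contra h4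
    have := mul_le_mul_of_nonneg_left (not_lt.1 h4) hn.le
    linarith
  · by_contra! hlt
    have hcp : 0 < ‖mat C 2 0‖ := norm_pos_iff.2 hc
    set c := ‖mat C 2 0‖ with hcdef
    -- Above `C⁻¹(∞)` the map `C` sends height `t` to `4 / (c² t)`; this choice keeps both heights
    -- above `R`.
    obtain ⟨t, ht1, ht2⟩ : ∃ t, R < t ∧ t < 4 / (c ^ 2 * R) := by
      apply exists_between
      rw [lt_div_iff₀ (by positivity)]
      nlinarith [mul_pos hR hcp]
    have ht : 0 < t := hR.trans ht1
    have hcc : conj (mat C 2 0) ≠ 0 := by simpa using hc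
    have f := herm_mat C⁻¹ ![1, 0, 0] ![1, 0, 0]
    simp [herm, mulVec, dotProduct, Fin.sum_univ_three, mat_inv_apply, Fin.rev] at f
    -- The first column of `C⁻¹` represents `C⁻¹(∞)`, and `f` says that it is null; subtracting `t /
    -- 2` raises the height from `0` to `t`.
    set z : ℂ × ℂ := (conj (mat C 2 2) / conj (mat C 2 0) - t / 2,
      conj (mat C 2 1) / conj (mat C 2 0)) with hz
    have hd : den C z = -(mat C 2 0 * t / 2) := by
      rw [den_eq, hz]
      field_simp
      linear_combination 2 * f
    have hd0 : den C z ≠ 0 := by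
      rw [hd]
      have : (t : ℂ) ≠ 0 := by exact_mod_cast ht.ne'
      simp [hc, this]
    have hh : height z = t := by
      have h1 : ((height z : ℝ) : ℂ) = t := by
        have h2 := herm_lift_self z
        rw [eq_neg_iff_add_eq_zero, ← eq_neg_iff_add_eq_zero, eq_comm, neg_eq_iff_eq_neg] at h2
        rw [h2]
        have h2c : conj (2 : ℂ) = 2 := map_ofNat _ 2
        simp only [herm, lift, hz]
        simp [h2c]
        field_simp
        linear_combination -2 * f
      exact_mod_cast h1
    have h3 := height_act_mul C hd0
    rw [hd, hh, Complex.normSq_eq_norm_sq] at h3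
    simp only [norm_neg, norm_div, norm_mul, Complex.norm_real, Real.norm_eq_abs, abs_of_pos ht,
      Complex.norm_ofNat, ← hcdef] at h3
    refine key z (by rw [hh]; exact ht1) ?_
    rw [lt_div_iff₀ (by positivity)] at ht2
    by_contra h4
    have := mul_le_mul_of_nonneg_left (not_lt.1 h4) (show 0 ≤ (c * t / 2) ^ 2 by positivity)
    rw [h3] at this
    nlinarith

/-! ### The volume of a fundamental box -/

/-- The parallelogram spanned by `a` and `b`. -/
def para (a b : ℂ) : Set ℂ :=
  {w | (conj w * b).im / (conj a * b).im ∈ Set.Ico (0 : ℝ) 1 ∧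
    (conj a * w).im / (conj a * b).im ∈ Set.Ico (0 : ℝ) 1}

/-- The part of a horoball at infinity over a parallelogram and an interval of length `s`. -/
def box (R s : ℝ) (a b : ℂ) : Set (ℂ × ℂ) :=
  {z | z ∈ hball R ∧ z.1.im ∈ Set.Ico 0 s ∧ z.2 ∈ para a b}

theorem measurableSet_para (a b : ℂ) : MeasurableSet (para a b) := by
  refine MeasurableSet.inter ?_ ?_
  · exact (show Measurable fun w : ℂ => (conj w * b).im / (conj a * b).im by fun_prop)
      measurableSet_Ico
  · exact (show Measurable fun w : ℂ => (conj a * w).im / (conj a * b).im by fun_prop)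
      measurableSet_Ico

theorem measurableSet_box (R s : ℝ) (a b : ℂ) : MeasurableSet (box R s a b) :=
  (measurableSet_hball R).inter
    (((Complex.measurable_im.comp measurable_fst) measurableSet_Ico).inter
      (measurable_snd (measurableSet_para a b)))

/-- Cramer's rule, `Im (ū v)` being the determinant of `u`, `v` as real vectors. -/
theorem para_decomp {a b : ℂ} (h : (conj a * b).im ≠ 0) (w : ℂ) :
    w = ((conj w * b).im / (conj a * b).im : ℝ) * a + ((conj a * w).im / (conj a * b).im : ℝ) * b := by
  have e : ∀ u v : ℂ, (conj u * v).im = u.re * v.im - u.im * v.re := by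
    intro u v
    simp [Complex.mul_im]; ring
  simp only [e] at h ⊢
  refine Complex.ext ?_ ?_
  · rw [Complex.add_re, Complex.re_ofReal_mul, Complex.re_ofReal_mul,
      div_mul_eq_mul_div, div_mul_eq_mul_div, ← add_div, eq_div_iff h]
    ring
  · rw [Complex.add_im, Complex.im_ofReal_mul, Complex.im_ofReal_mul,
      div_mul_eq_mul_div, div_mul_eq_mul_div, ← add_div, eq_div_iff h]
    ring

theorem volume_unit_square :
    volume (Set.Ico (0 : ℝ) 1 ×ℂ Set.Ico (0 : ℝ) 1) = 1 := by
  have : Set.Ico (0 : ℝ) 1 ×ℂ Set.Ico (0 : ℝ) 1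
      = Complex.measurableEquivRealProd ⁻¹' (Set.Ico (0 : ℝ) 1 ×ˢ Set.Ico (0 : ℝ) 1) := rfl
  rw [this, Complex.volume_preserving_equiv_real_prod.measure_preimage
    (measurableSet_Ico.prod measurableSet_Ico).nullMeasurableSet, Measure.volume_eq_prod,
    Measure.prod_prod]
  simp

theorem volume_para_le {a b : ℂ} (h : (conj a * b).im ≠ 0) :
    volume (para a b) ≤ ENNReal.ofReal |(conj a * b).im| := by
  let f : ℂ →ₗ[ℝ] ℂ := toLin Complex.basisOneI Complex.basisOneI !![a.re, b.re; a.im, b.im]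
  have hf : ∀ x y : ℝ, f (⟨x, y⟩ : ℂ) = x * a + y * b := by
    intro x y
    simp only [f, toLin_apply, mulVec, dotProduct, Fin.sum_univ_two, Complex.coe_basisOneI_repr,
      Complex.coe_basisOneI]
    apply Complex.ext <;> simp <;> ring
  have hdet : LinearMap.det f = (conj a * b).im := by
    simp [f, det_fin_two]; ring
  have hsub : para a b ⊆ f '' (Set.Ico (0 : ℝ) 1 ×ℂ Set.Ico (0 : ℝ) 1) := fun w hw =>
    ⟨⟨_, _⟩, ⟨hw.1, hw.2⟩, by rw [hf]; exact (para_decomp h w).symm⟩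
  refine (measure_mono hsub).trans ?_
  rw [Measure.addHaar_image_linearMap, hdet, volume_unit_square, mul_one]

/-- With `x = -Re z₁` and `c = |z₂|²` the height is `2 x - c`. The value does not depend on `c`, so
all sections of the box over the parallelogram have equal mass. -/
theorem lintegral_height_section {R : ℝ} (hR : 0 < R) (c : ℝ) :
    ∫⁻ x in Set.Ioi ((R + c) / 2), ENNReal.ofReal (16 / (2 * x - c) ^ 3)
      = ENNReal.ofReal (4 / R ^ 2) := by
  have hpos : ∀ x ∈ Set.Ici ((R + c) / 2), 0 < 2 * x - c := by
    intro x hx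
    have : (R + c) / 2 ≤ x := hx
    linarith
  have hd : ∀ x ∈ Set.Ici ((R + c) / 2),
      HasDerivAt (fun x : ℝ => -(4 / (2 * x - c) ^ 2)) (16 / (2 * x - c) ^ 3) x := by
    intro x hx
    have h0 := (hpos x hx).ne'
    have h1 : HasDerivAt (fun x : ℝ => 2 * x - c) 2 x := by
      simpa using ((hasDerivAt_id x).const_mul 2).sub_const c
    refine (((hasDerivAt_const x (4 : ℝ)).fun_div (h1.fun_pow 2) (by positivity)).fun_neg).congr_deriv ?_
    field_simp
    ring
  have hnn : ∀ x ∈ Set.Ioi ((R + c) / 2), 0 ≤ 16 / (2 * x - c) ^ 3 := by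
    intro x hx
    have := hpos x (Set.Ioi_subset_Ici_self hx)
    positivity
  have hlim : Filter.Tendsto (fun x : ℝ => -(4 / (2 * x - c) ^ 2)) Filter.atTop (nhds 0) := by
    rw [← neg_zero]
    refine Filter.Tendsto.neg (Filter.Tendsto.const_div_atTop ?_ 4)
    refine (Filter.tendsto_pow_atTop two_ne_zero).comp ?_
    exact Filter.tendsto_atTop_add_const_right _ (-c)
      (Filter.tendsto_id.const_mul_atTop (by norm_num : (0 : ℝ) < 2))
  have hi := integrableOn_Ioi_deriv_of_nonneg' hd hnn hlim
  rw [← ofReal_integral_eq_lintegral_ofReal hi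
    ((ae_restrict_iff' measurableSet_Ioi).2 (Filter.Eventually.of_forall hnn)),
    integral_Ioi_of_hasDerivAt_of_nonneg' hd hnn hlim]
  rw [show 2 * ((R + c) / 2) - c = R by ring]
  congr 1
  ring

theorem vol_box_le {R s : ℝ} (hR : 0 < R) {a b : ℂ} (h : (conj a * b).im ≠ 0) :
    vol (box R s a b) ≤ ENNReal.ofReal (4 / R ^ 2) * ENNReal.ofReal s *
      ENNReal.ofReal |(conj a * b).im| := by
  have hm := measurableSet_box R s a b
  rw [vol_eq_lintegral hm fun z hz => hball_subset_plane hR.le hz.1, ← lintegral_indicator hm,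
    Measure.volume_eq_prod, lintegral_prod_symm']
  swap
  · refine Measurable.indicator ?_ hm
    exact ((continuous_height.measurable.pow_const 3).const_div 16).ennreal_ofReal
  have hsec : ∀ w : ℂ, ∫⁻ z : ℂ, (box R s a b).indicator
      (fun z => ENNReal.ofReal (16 / height z ^ 3)) (z, w)
      = (para a b).indicator (fun _ => ENNReal.ofReal (4 / R ^ 2) * ENNReal.ofReal s) w := by
    intro w
    by_cases hw : w ∈ para a b
    swap
    · rw [Set.indicator_of_notMem hw]
      simp [box, hw]
    rw [Set.indicator_of_mem hw]
    set c := Complex.normSq w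
    let G : ℝ → ℝ≥0∞ := (Set.Ioi ((R + c) / 2)).indicator
      fun x => ENNReal.ofReal (16 / (2 * x - c) ^ 3)
    let H : ℝ → ℝ≥0∞ := (Set.Ico 0 s).indicator fun _ => 1
    have hG : Measurable G := Measurable.indicator (by fun_prop) measurableSet_Ioi
    have hH : Measurable H := Measurable.indicator (by fun_prop) measurableSet_Ico
    have e : ∀ z : ℂ, (box R s a b).indicator (fun z => ENNReal.ofReal (16 / height z ^ 3)) (z, w)
        = G (-z.re) * H z.im := by
      intro z
      have h1 : z.re = -(-z.re) := by ring
      have hh : height (z, w) = 2 * (-z.re) - c := by rw [height_eq]; simp only [c]; ring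
      have h2 : (z, w) ∈ box R s a b ↔ -z.re ∈ Set.Ioi ((R + c) / 2) ∧ z.im ∈ Set.Ico 0 s := by
        simp only [box, hball, Set.mem_ofPred_eq, hh, hw, and_true, Set.mem_Ioi]
        refine and_congr_left' ?_
        rw [div_lt_iff₀ two_pos, ← sub_pos, ← sub_pos (b := R + c)]
        ring_nf
      by_cases h3 : -z.re ∈ Set.Ioi ((R + c) / 2)
      · by_cases h4 : z.im ∈ Set.Ico 0 s
        · rw [Set.indicator_of_mem (h2.2 ⟨h3, h4⟩)]
          simp only [G, H]
          rw [Set.indicator_of_mem h3, Set.indicator_of_mem h4, mul_one, hh]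
        · rw [Set.indicator_of_notMem (fun h => h4 (h2.1 h).2)]
          simp only [H]
          rw [Set.indicator_of_notMem h4, mul_zero]
      · rw [Set.indicator_of_notMem (fun h => h3 (h2.1 h).1)]
        simp only [G]
        rw [Set.indicator_of_notMem h3, zero_mul]
    calc _ = ∫⁻ z : ℂ, G (-z.re) * H z.im := lintegral_congr e
      _ = ∫⁻ z : ℝ × ℝ, G (-z.1) * H z.2 :=
        Complex.volume_preserving_equiv_real_prod.lintegral_comp
          (f := fun z : ℝ × ℝ => G (-z.1) * H z.2)
          ((hG.comp measurable_fst.neg).mul (hH.comp measurable_snd))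
      _ = (∫⁻ x : ℝ, G (-x)) * ∫⁻ y : ℝ, H y := by
        rw [Measure.volume_eq_prod]
        exact lintegral_prod_mul (hG.comp measurable_neg).aemeasurable hH.aemeasurable
      _ = (∫⁻ x : ℝ, G x) * ∫⁻ y : ℝ, H y := by
        rw [lintegral_neg_eq_self]
      _ = _ := by
        simp only [G, H]
        rw [lintegral_indicator measurableSet_Ioi, lintegral_indicator measurableSet_Ico,
          lintegral_height_section hR c]
        simp
  simp_rw [hsec]
  rw [lintegral_indicator (measurableSet_para a b), setLIntegral_const]
  gcongr
  exact volume_para_le h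

/-! ### Packing translates into a box -/

theorem mem_scalars_of_fixed {g : SU21} (hg : Fixes g infPt) {z w : ℂ × ℂ} (hz : act g z = z)
    (hw : act g w = w) (hne : z.2 ≠ w.2) : g ∈ scalars := by
  obtain ⟨h10, h20, h21, h00, h11, h12, -⟩ := fixes_infPt hg
  have h22 : mat g 2 2 ≠ 0 := by intro h; simp [h] at h00
  have e : ∀ z, act g z = z → mat g 0 0 * z.1 + mat g 0 1 * z.2 + mat g 0 2 = mat g 2 2 * z.1 ∧
      mat g 1 1 * z.2 + mat g 1 2 = mat g 2 2 * z.2 := by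
    intro z hz
    have h0 := congrArg Prod.fst hz
    have h1 := congrArg Prod.snd hz
    simp [act, mulVec, dotProduct, Fin.sum_univ_three, lift, h10, h20, h21] at h0 h1
    rw [div_eq_iff h22] at h0 h1
    exact ⟨by rw [h0]; ring, by rw [h1]; ring⟩
  have d1 : mat g 1 1 = mat g 2 2 := by
    have : (mat g 1 1 - mat g 2 2) * (z.2 - w.2) = 0 := by
      linear_combination (e z hz).2 - (e w hw).2
    exact sub_eq_zero.1 ((mul_eq_zero.1 this).resolve_right (sub_ne_zero.2 hne))
  have d12 : mat g 1 2 = 0 := by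
    have := (e z hz).2
    rw [d1] at this
    linear_combination this
  have d01 : mat g 0 1 = 0 := by simpa [d12, h22] using h12
  have d0 : mat g 0 0 = mat g 2 2 := by
    rw [d1] at h11
    have h22' : conj (mat g 2 2) ≠ 0 := by simpa using h22
    exact mul_right_cancel₀ h22' (h00.trans h11.symm)
  have d02 : mat g 0 2 = 0 := by
    have := (e z hz).1
    rw [d0, d01] at this
    linear_combination this
  refine ⟨mat g 2 2, ?_⟩
  ext i j
  fin_cases i <;> fin_cases j <;> simp [h10, h20, h21, d1, d12, d01, d0, d02]

theorem measurableSet_fixed (g : SU21) : MeasurableSet {z | act g z = z} :=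
  measurableSet_eq_fun (measurable_act g) measurable_id

/-- All fixed points share one second coordinate, by `mem_scalars_of_fixed`, so they lie in a null
slice. -/
theorem vol_fixed {g : SU21} (hg : Fixes g infPt) (hs : g ∉ scalars) :
    vol {z | act g z = z} = 0 := by
  rcases Set.eq_empty_or_nonempty {z | act g z = z} with h | ⟨w, hw⟩
  · simp [h]
  · have hsub : {z | act g z = z} ⊆ Set.univ ×ˢ {w.2} := by
      intro z hz
      by_contra h
      exact hs (mem_scalars_of_fixed hg hz hw (by simpa using h))
    refine measure_mono_null hsub (vol_eq_zero_of_volume_eq_zero ?_)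
    rw [Measure.volume_eq_prod, Measure.prod_prod]
    simp

/-- Each `g l` image of `F` is cut into pieces that the `γ k` carry into `D`, where pieces overlap
only in null sets. The `γ k` need not form a group. -/
theorem packing {κ : Type*} [Countable κ] {n : ℕ} {B D F : Set (ℂ × ℂ)} (hB : B ⊆ plane)
    (hD : MeasurableSet D) (hF : MeasurableSet F) (hFB : F ⊆ B) (γ : κ → SU21) (g : Fin n → SU21)
    (hg : ∀ l, act (g l) '' B = B) (hcov : ∀ z ∈ B, ∃ k, act (γ k) z ∈ D)
    (hnull : ∀ i j : Fin n × κ, i ≠ j →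
      vol (act (γ i.2 * g i.1) '' F ∩ act (γ j.2 * g j.1) '' F) = 0) :
    n * vol F ≤ vol D := by
  have hFp := hFB.trans hB
  have h1 : ∑' i : Fin n × κ, vol (act (γ i.2 * g i.1) '' F ∩ D) ≤ vol D := by
    refine (tsum_meas_le_meas_iUnion_of_disjoint₀ vol (fun i =>
      ((measurableSet_image_act _ hFp hF).inter hD).nullMeasurableSet) ?_).trans
      (measure_mono (Set.iUnion_subset fun i => Set.inter_subset_right))
    intro i j hij
    exact measure_mono_null (Set.inter_subset_inter Set.inter_subset_left Set.inter_subset_left)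
      (hnull i j hij)
  refine le_trans ?_ h1
  rw [ENNReal.tsum_prod (f := fun l k => vol (act (γ k * g l) '' F ∩ D)), tsum_fintype]
  have h2 : ∀ l : Fin n, vol F ≤ ∑' k, vol (act (γ k * g l) '' F ∩ D) := by
    intro l
    set X := act (g l) '' F
    have hXB : X ⊆ B := (Set.image_mono hFB).trans (hg l).le
    have hXm : MeasurableSet X := measurableSet_image_act _ hFp hF
    rw [← vol_image_act (g l) hFp hF]
    calc vol X ≤ vol (⋃ k, X ∩ act (γ k) ⁻¹' D) := measure_mono fun z hz => by
          obtain ⟨k, hk⟩ := hcov z (hXB hz)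
          exact Set.mem_iUnion.2 ⟨k, hz, hk⟩
      _ ≤ ∑' k, vol (X ∩ act (γ k) ⁻¹' D) := measure_iUnion_le _
      _ = _ := by
        refine tsum_congr fun k => ?_
        rw [image_act_mul _ _ hFp, ← Set.image_inter_preimage (act (γ k)), vol_image_act _
          (Set.inter_subset_left.trans (hXB.trans hB)) (hXm.inter (measurable_act _ hD))]
  calc (n : ℝ≥0∞) * vol F = ∑ _l : Fin n, vol F := by simp
    _ ≤ _ := Finset.sum_le_sum fun l _ => h2 l

/-- By injectivity into the quotient, an overlap comes only from fixed points of `h⁻¹ h'`. -/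
theorem null_of_injective {G : Subgroup SU21} {F : Set (ℂ × ℂ)} (hG : ∀ g ∈ G, Fixes g infPt)
    (hFp : F ⊆ plane) (hF : MeasurableSet F)
    (hinj : ∀ x ∈ F, ∀ y ∈ F, ∀ g ∈ G, act g x = y → x = y) {h h' : SU21} (hh : h ∈ G)
    (hh' : h' ∈ G) (hs : h⁻¹ * h' ∉ scalars) : vol (act h '' F ∩ act h' '' F) = 0 := by
  have hG' : h⁻¹ * h' ∈ G := G.mul_mem (G.inv_mem hh) hh'
  have hsub : act h '' F ∩ act h' '' F ⊆ act h' '' (F ∩ {z | act (h⁻¹ * h') z = z}) := by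
    rintro z ⟨⟨x, hx, hxz⟩, y, hy, rfl⟩
    have e : act (h⁻¹ * h') y = x := by
      rw [act_mul _ _ (hFp hy), ← hxz, act_inv_act _ (hFp hx)]
    have := hinj y hy x hx _ hG' e
    exact ⟨y, ⟨hy, e.trans this.symm⟩, rfl⟩
  refine measure_mono_null hsub ?_
  rw [vol_image_act _ (Set.inter_subset_left.trans hFp) (hF.inter (measurableSet_fixed _))]
  exact measure_mono_null Set.inter_subset_right (vol_fixed (hG _ hG') hs)

theorem scalars_comm {σ : SU21} (hσ : σ ∈ scalars) (g : SU21) : g * σ = σ * g := by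
  obtain ⟨c, hc⟩ := hσ
  apply mat_injective
  rw [mat_mul, mat_mul, hc]
  simp

theorem scalars_le_heisenberg (p : NullVec) : scalars ≤ heisenberg p := by
  rintro σ ⟨c, hc⟩
  have h0 : c ≠ 0 := by
    rintro rfl
    have := mat_det σ
    simp [hc] at this
  refine ⟨⟨c, by simp [hc, smul_mulVec]⟩, c⁻¹, ?_⟩
  rw [hc, smul_smul, inv_mul_cancel₀ h0]
  simp

/-- For infinite `α` the right side is `k / 0 = 0`; this is still correct, as arbitrarily many
copies of `v` fit below `k`. Infinite index thus needs no separate treatment. -/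
theorem le_ofReal_div_of_forall {α : Type*} [Nonempty α] {v : ℝ≥0∞} {k : ℝ}
    (h : ∀ n : ℕ, (Fin n ↪ α) → n * v ≤ ENNReal.ofReal k) :
    v ≤ ENNReal.ofReal (k / Nat.card α) := by
  cases finite_or_infinite α with
  | inl hfin =>
    have hm : 0 < Nat.card α := Nat.card_pos
    rw [ENNReal.ofReal_div_of_pos (by exact_mod_cast hm), ENNReal.ofReal_natCast,
      ENNReal.le_div_iff_mul_le (by simp [hm.ne']) (by simp), mul_comm]
    exact h _ (Finite.equivFin α).symm.toEmbedding
  | inr hinf =>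
    have : v = 0 := by
      by_contra hv
      obtain ⟨n, hn⟩ := ENNReal.exists_nat_mul_gt hv (b := ENNReal.ofReal k) ENNReal.ofReal_ne_top
      exact absurd (h n ((Fin.valEmbedding).trans (Infinite.natEmbedding α))) (not_le.2 hn)
    rw [this]
    exact zero_le

theorem exists_int_add_mul_mem_Ico {s : ℝ} (hs : s ≠ 0) (v : ℝ) :
    ∃ k : ℤ, v + k * s ∈ Set.Ico 0 |s| := by
  obtain ⟨n, hn, -⟩ := existsUnique_add_zsmul_mem_Ico (abs_pos.2 hs) v 0
  rw [zero_add, zsmul_eq_mul] at hn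
  rcases abs_choice s with h | h
  · exact ⟨n, by rw [h] at hn ⊢; exact hn⟩
  · refine ⟨-n, ?_⟩
    rw [h] at hn ⊢
    simpa using hn

/-- The volume bound for a group fixing infinity, in terms of the entries of the generators. -/
theorem vol_le_of_commutator {G : Subgroup SU21} {R : ℝ} (hR : 0 < R)
    (hG : ∀ g ∈ G, Fixes g infPt) (hinv : ∀ g ∈ G, act g '' hball R = hball R)
    {a b t : SU21} (ha : a ∈ G ⊓ heisenberg infPt) (hb : b ∈ G ⊓ heisenberg infPt)
    (ht : t ∈ G ⊓ heisenberg infPt) {x : ℂ} (hx : x ≠ 0) (htx : HeisTrans t 0 x)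
    {q : ℕ} (hq : 0 < q) (hab : HeisTrans (a * b * a⁻¹ * b⁻¹) 0 (q * x))
    {F : Set (ℂ × ℂ)} (hF : MeasurableSet F) (hFB : F ⊆ hball R)
    (hinj : ∀ x ∈ F, ∀ y ∈ F, ∀ g ∈ G, act g x = y → x = y) :
    vol F ≤ ENNReal.ofReal
      (2 * q * x.im ^ 2 / R ^ 2 / (G ⊓ heisenberg infPt).relIndex G) := by
  obtain ⟨τ, xa, hτ⟩ := exists_heisTrans ha.2
  obtain ⟨τ', xb, hτ'⟩ := exists_heisTrans hb.2
  have hxre := heisTrans_re htx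
  have hs : x.im ≠ 0 := fun h => hx (Complex.ext hxre h)
  -- Comparing vertical parts in `[a, b] b a = a b` ties the signed area `A` to `q` and `x`.
  set A : ℝ := (conj τ * τ').im with hA
  have hqA : (q : ℝ) * x.im = -(2 * A) := by
    have h1 := hab.mul (hτ'.mul hτ)
    have h2 : a * b * a⁻¹ * b⁻¹ * (b * a) = a * b := by group
    rw [h2] at h1
    have h3 := congrArg Complex.im ((hτ.mul hτ').unique h1).2
    simp [hA] at h3 ⊢
    linarith
  have hq0 : (0 : ℝ) < q := by exact_mod_cast hq
  have hA0 : A ≠ 0 := by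
    intro h
    rw [h] at hqA
    simp [hs, hq.ne'] at hqA
  have hbox := vol_box_le (s := |x.im|) hR hA0
  rw [← hA, ← ENNReal.ofReal_mul (by positivity), ← ENNReal.ofReal_mul (by positivity)] at hbox
  have hval : 4 / R ^ 2 * |x.im| * |A| = 2 * q * x.im ^ 2 / R ^ 2 := by
    have : |A| = q * |x.im| / 2 := by
      have h := congrArg abs hqA
      rw [abs_mul, abs_neg, abs_mul, abs_of_pos hq0, abs_two] at h
      linarith
    rw [this, ← sq_abs x.im]
    ring
  rw [hval] at hbox
  let γ : ℤ × ℤ × ℤ → SU21 := fun k => a ^ k.1 * b ^ k.2.1 * t ^ k.2.2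
  have hγΛ : ∀ k, γ k ∈ G ⊓ heisenberg infPt := fun k =>
    mul_mem (mul_mem (zpow_mem ha _) (zpow_mem hb _)) (zpow_mem ht _)
  have hγ : ∀ i j : ℤ, ∃ y, ∀ k : ℤ, HeisTrans (γ (i, j, k)) (i * τ + j * τ') (y + k * x) := by
    intro i j
    obtain ⟨y, hy, -⟩ := hτ.zpow i
    obtain ⟨y', hy', -⟩ := hτ'.zpow j
    refine ⟨y + y' - conj (i * τ) * (j * τ'), fun k => ?_⟩
    obtain ⟨y'', hy'', h0⟩ := htx.zpow k
    have := (hy.mul hy').mul hy''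
    rw [h0 rfl] at this
    simpa using this
  have hγinj : ∀ k k' : ℤ × ℤ × ℤ, ∀ σ ∈ scalars, γ k' = γ k * σ → k = k' := by
    rintro ⟨i, j, k⟩ ⟨i', j', k'⟩ σ hσ h
    obtain ⟨y, hy⟩ := hγ i j
    obtain ⟨y', hy'⟩ := hγ i' j'
    have h1 := (hy k).mul_scalar hσ
    rw [← h] at h1
    have h2 := ((hy' k').unique h1).1
    have hi : i' = i := by
      have h3 := congrArg (fun w => (conj w * τ').im) h2
      have h4 : ((i' : ℝ) - i) * A = 0 := by
        rw [hA]
        simp at h3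
        simp only [Complex.mul_im, Complex.conj_re, Complex.conj_im]
        linear_combination h3
      simpa [hA0, sub_eq_zero] using h4
    have hj : j' = j := by
      have h3 := congrArg (fun w => (conj τ * w).im) h2
      have h4 : ((j' : ℝ) - j) * A = 0 := by
        rw [hA]
        simp at h3
        simp only [Complex.mul_im, Complex.conj_re, Complex.conj_im]
        linear_combination h3
      simpa [hA0, sub_eq_zero] using h4
    subst hi hj
    have h3 := ((hy k').unique h1).2
    have hk : k' = k := by simpa [hx] using h3
    rw [hk]
  have hcov : ∀ z ∈ hball R, ∃ k, act (γ k) z ∈ box R |x.im| τ τ' := by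
    intro z hz
    -- The powers of `a` and `b` bring `z.2` into the parallelogram; the power of `t` then adjusts
    -- `Im z.1` without moving `z.2`.
    set i : ℤ := -⌊(conj z.2 * τ').im / A⌋ with hi
    set j : ℤ := -⌊(conj τ * z.2).im / A⌋ with hj
    obtain ⟨y, hy⟩ := hγ i j
    obtain ⟨k, hk⟩ := exists_int_add_mul_mem_Ico hs
      ((z.1 - conj (i * τ + j * τ') * z.2 + y).im)
    refine ⟨(i, j, k), ?_, ?_, ?_⟩
    · rw [← hinv _ (hγΛ (i, j, k)).1]
      exact ⟨z, hz, rfl⟩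
    · rw [(hy k).act_eq]
      convert hk using 1
      simp [hxre]
      ring
    · rw [(hy k).act_eq]
      have e1 : (conj (z.2 + (i * τ + j * τ')) * τ').im / A
          = Int.fract ((conj z.2 * τ').im / A) := by
        rw [Int.fract, div_eq_iff hA0, sub_mul, div_mul_cancel₀ _ hA0]
        have : ((⌊(conj z.2 * τ').im / A⌋ : ℤ) : ℝ) = -(i : ℝ) := by rw [hi]; push_cast; ring
        rw [this, hA]
        simp
        ring
      have e2 : (conj τ * (z.2 + (i * τ + j * τ'))).im / A
          = Int.fract ((conj τ * z.2).im / A) := by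
        rw [Int.fract, div_eq_iff hA0, sub_mul, div_mul_cancel₀ _ hA0]
        have : ((⌊(conj τ * z.2).im / A⌋ : ℤ) : ℝ) = -(j : ℝ) := by rw [hj]; push_cast; ring
        rw [this, hA]
        simp
        ring
      simp only [para, Set.mem_ofPred_eq, ← hA, e1, e2]
      exact ⟨⟨Int.fract_nonneg _, Int.fract_lt_one _⟩, Int.fract_nonneg _, Int.fract_lt_one _⟩
  refine le_ofReal_div_of_forall (α := G ⧸ (G ⊓ heisenberg infPt).subgroupOf G) fun n δ => ?_
  refine le_trans ?_ hbox
  have hFp := hFB.trans (hball_subset_plane hR.le)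
  let d : Fin n → SU21 := fun l => ((δ l).out : G)
  have hdG : ∀ l, d l ∈ G := fun l => ((δ l).out : G).2
  have hd : ∀ l l', (d l)⁻¹ * d l' ∈ G ⊓ heisenberg infPt → l = l' := by
    intro l l' h
    apply δ.injective
    rw [← Quotient.out_eq' (δ l), ← Quotient.out_eq' (δ l')]
    exact Quotient.sound' (QuotientGroup.leftRel_apply.2 (Subgroup.mem_subgroupOf.2 h))
  -- The `d l` represent distinct left cosets of the translations; since the `γ k` multiply from the
  -- left, the inverses are needed.
  refine packing (hball_subset_plane hR.le) (measurableSet_box _ _ _ _) hF hFB γ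
    (fun l => (d l)⁻¹) (fun l => hinv _ (G.inv_mem (hdG l))) hcov ?_
  have hmem : ∀ i : Fin n × (ℤ × ℤ × ℤ), γ i.2 * (d i.1)⁻¹ ∈ G := fun i =>
    G.mul_mem (hγΛ _).1 (G.inv_mem (hdG _))
  rintro ⟨l, k⟩ ⟨l', k'⟩ hne
  refine null_of_injective hG hFp hF hinj (hmem (l, k)) (hmem (l', k')) fun hσ => hne ?_
  have hσG := G.mul_mem (G.inv_mem (hmem (l, k))) (hmem (l', k'))
  obtain ⟨σ, hσe⟩ : ∃ σ, σ = (γ k * (d l)⁻¹)⁻¹ * (γ k' * (d l')⁻¹) := ⟨_, rfl⟩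
  simp only at hσ hσG
  rw [← hσe] at hσ hσG
  have e : γ k' * (d l')⁻¹ = γ k * (d l)⁻¹ * σ := by rw [hσe]; group
  have e1 : (d l)⁻¹ * d l' = (γ k)⁻¹ * γ k' * σ⁻¹ := by
    have e2 : γ k' = γ k * (d l)⁻¹ * σ * d l' := by rw [← e]; group
    rw [e2, mul_assoc (γ k * (d l)⁻¹), ← scalars_comm hσ]
    group
  -- Two movers differing by a scalar give the same coset, because scalars count as Heisenberg
  -- translations.
  have hl : l = l' := hd l l' (by
    rw [e1]
    exact mul_mem (mul_mem (inv_mem (hγΛ k)) (hγΛ k'))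
      (inv_mem ⟨hσG, scalars_le_heisenberg _ hσ⟩))
  subst hl
  have hk : k = k' := hγinj k k' σ hσ (by
    rw [mul_assoc (γ k), scalars_comm hσ, ← mul_assoc] at e
    exact mul_right_cancel e)
  rw [hk]

/-! ### The bound at infinity -/

/-- A horoball that is invariant under a non-trivial vertical translation is based at infinity. -/
theorem exists_eq_hball {B : Set (ℂ × ℂ)} (hB : IsHoroball B) {g : SU21} {x : ℂ} (hx : x ≠ 0)
    (hg : HeisTrans g 0 x) (hinv : act g '' B = B) : ∃ R, 0 < R ∧ B = hball R := by
  obtain ⟨p, r, hr, rfl⟩ := hB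
  have hn := p.2.2
  by_cases h2 : p.1 2 = 0
  · refine horoball_eq_hball p r hr ?_ h2
    simpa [herm, h2] using hn
  exfalso
  have h2c : conj (p.1 2) ≠ 0 := by simpa using h2
  have hmem : ∀ z, z ∈ horoball p r ↔ 0 < height z ∧ r * ‖herm (lift z) p.1‖ ^ 2 < height z :=
    fun z => and_congr_left' (mem_plane_iff z)
  set N := ‖p.1 2‖ with hN
  have hNp : 0 < N := norm_pos_iff.2 h2
  obtain ⟨w, hw⟩ : ∃ w, w ∈ horoball p r := by
    -- The point at height `ε` above `p` lies in the horoball whenever `ε < 4 / (r N²)`.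
    set ε : ℝ := 1 / (r * N ^ 2) with hε
    have hεp : 0 < ε := by positivity
    set w : ℂ × ℂ := (p.1 0 / p.1 2 - (ε : ℂ) / 2, p.1 1 / p.1 2)
    have e1 : herm (lift w) p.1 = -(ε / 2 * conj (p.1 2)) := by
      simp only [herm] at hn
      simp [herm, lift, w]
      field_simp
      linear_combination 2 * hn
    have e2 : height w = ε := by
      have h1 : (height w : ℂ) = ε := by
        have h := herm_lift_self w
        have h' : (height w : ℂ) = -herm (lift w) (lift w) := by rw [h, neg_neg]
        rw [h']
        have h22 : conj (2 : ℂ) = 2 := map_ofNat _ 2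
        simp only [herm] at hn
        simp [herm, lift, w, h22]
        field_simp
        linear_combination -2 * hn
      exact_mod_cast h1
    refine ⟨w, (hmem w).2 ⟨by rw [e2]; exact hεp, ?_⟩⟩
    rw [e1, e2, norm_neg, norm_mul, norm_div, Complex.norm_real, RCLike.norm_conj,
      Real.norm_of_nonneg hεp.le, Complex.norm_ofNat, ← hN]
    have : r * (ε / 2 * N) ^ 2 = ε / 4 * (ε * (r * N ^ 2)) := by ring
    rw [this, hε, one_div_mul_cancel (by positivity), ← hε]
    linarith
  have hit : ∀ n : ℕ, (w.1 + n * x, w.2) ∈ horoball p r := by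
    intro n
    induction n with
    | zero => simpa using hw
    | succ n ih =>
      rw [← hinv]
      refine ⟨_, ih, ?_⟩
      rw [hg.act_eq]
      ext
      · simp; ring
      · simp
  have hre := heisTrans_re hg
  have hxn : 0 < ‖x‖ := norm_pos_iff.2 hx
  -- Since `x` is imaginary the translates of `w` keep their height, while their pairing with `p`
  -- grows linearly in `n`.
  have hbd : ∀ n : ℕ, r * ‖herm (lift w) p.1 + n * x * conj (p.1 2)‖ ^ 2 < height w := by
    intro n
    have h := ((hmem _).1 (hit n)).2
    have e1 : herm (lift (w.1 + n * x, w.2)) p.1 = herm (lift w) p.1 + n * x * conj (p.1 2) := by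
      simp [herm, lift]; ring
    have e2 : height (w.1 + n * x, w.2) = height w := by
      rw [height_eq, height_eq]; simp [hre]
    rwa [e1, e2] at h
  set H := ‖herm (lift w) p.1‖
  obtain ⟨n, hn'⟩ := exists_nat_gt ((H + (height w / r + 1)) / (‖x‖ * N))
  rw [div_lt_iff₀ (by positivity)] at hn'
  have h1 : (n : ℝ) * (‖x‖ * N) - H ≤ ‖herm (lift w) p.1 + n * x * conj (p.1 2)‖ := by
    have h := norm_sub_le (herm (lift w) p.1 + n * x * conj (p.1 2)) (herm (lift w) p.1)
    rw [add_sub_cancel_left, norm_mul, norm_mul, RCLike.norm_conj, Complex.norm_natCast] at h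
    rw [← hN] at h
    linarith
  have h2 := hbd n
  have hw0 := ((hmem w).1 hw).1
  have h3 : 0 < height w / r := by positivity
  have h4 : height w / r + 1 < ‖herm (lift w) p.1 + n * x * conj (p.1 2)‖ := by linarith
  rw [mul_comm, ← lt_div_iff₀ hr] at h2
  nlinarith

theorem bound_at_infinity {G : Subgroup SU21} (hG : ∀ g ∈ G, Fixes g infPt) {B : Set (ℂ × ℂ)}
    (hB : IsHoroball B) (hinv : ∀ g ∈ G, act g '' B = B)
    {a b T σ : SU21} (ha : a ∈ G ⊓ heisenberg infPt) (hb : b ∈ G ⊓ heisenberg infPt)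
    (ht : T * σ ∈ G ⊓ heisenberg infPt) (hσ : σ ∈ scalars) (htr : (mat T).trace = 3)
    {q : ℕ} (hq : 0 < q) (hTq : T ^ q ≠ 1) (hab : a * b * a⁻¹ * b⁻¹ = T ^ q)
    {C : SU21} (hC : Disjoint (act C '' B) B) :
    (mat (T * C * T * C⁻¹)).trace.im = 0 ∧
      quotientVolume G B ≤ ENNReal.ofReal ((3 - (mat (T * C * T * C⁻¹)).trace.re) * q /
        (2 * (G ⊓ heisenberg infPt).relIndex G)) := by
  have hTh : T ∈ heisenberg infPt := by
    have := (heisenberg infPt).mul_mem ht.2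
      ((heisenberg infPt).inv_mem (scalars_le_heisenberg infPt hσ))
    rwa [mul_inv_cancel_right] at this
  obtain ⟨τ, x, hT⟩ := heisMat_of_trace hTh htr
  have hTt : HeisTrans T τ x := ⟨1, one_ne_zero, by rw [hT, one_smul]⟩
  -- Horizontal parts add, so the commutator `T ^ q` has none, and `q τ = 0`.
  have hτ : τ = 0 := by
    obtain ⟨τa, xa, hτa⟩ := exists_heisTrans ha.2
    obtain ⟨τb, xb, hτb⟩ := exists_heisTrans hb.2
    have h1 := ((hτa.mul hτb).mul hτa.inv).mul hτb.inv
    obtain ⟨y, h2, -⟩ := hTt.zpow q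
    rw [zpow_natCast, ← hab] at h2
    have h3 := (h2.unique h1).1
    have h4 : (q : ℂ) * τ = 0 := by
      push_cast at h3
      linear_combination h3
    simpa [hq.ne'] using h4
  subst hτ
  have hqt : HeisTrans (T ^ q) 0 (q * x) := by
    obtain ⟨y, h2, h3⟩ := hTt.zpow q
    rw [zpow_natCast, h3 rfl] at h2
    simpa using h2
  have hx : x ≠ 0 := by
    rintro rfl
    apply hTq
    have : T = 1 := mat_injective (by rw [hT, heisMat_zero, mat_one])
    rw [this, one_pow]
  have hqx : (q : ℂ) * x ≠ 0 := mul_ne_zero (by exact_mod_cast hq.ne') hx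
  -- Being a commutator, `T ^ q` lies in `G` exactly, whereas `T` does so only up to a scalar.
  have hTqG : T ^ q ∈ G := by
    rw [← hab]
    exact mul_mem (mul_mem (mul_mem ha.1 hb.1) (inv_mem ha.1)) (inv_mem hb.1)
  obtain ⟨R, hR, rfl⟩ := exists_eq_hball hB hqx hqt (hinv _ hTqG)
  have hc := two_le_of_disjoint hR C hC
  have hre := heisTrans_re hTt
  have htrace : (mat (T * C * T * C⁻¹)).trace
      = ((3 - x.im ^ 2 * ‖mat C 2 0‖ ^ 2 : ℝ) : ℂ) := by
    rw [trace_conj_heis hT, Complex.mul_conj, Complex.normSq_eq_norm_sq]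
    have : x = x.im * Complex.I := Complex.ext (by simp [hre]) (by simp)
    rw [this]
    simp [mul_pow]
    ring
  rw [htrace, Complex.ofReal_im, Complex.ofReal_re]
  refine ⟨rfl, iSup₂_le fun F hF => ?_⟩
  rw [← hab] at hqt
  refine (vol_le_of_commutator hR hG hinv ha hb ht hx (hTt.mul_scalar hσ) hq hqt hF.1 hF.2.1
    hF.2.2).trans (ENNReal.ofReal_le_ofReal ?_)
  rw [← div_div]
  refine div_le_div_of_nonneg_right ?_ (Nat.cast_nonneg _)
  rw [div_le_iff₀ (by positivity)]
  have h4 : 4 ≤ (R * ‖mat C 2 0‖) ^ 2 := by nlinarith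
  have h5 := mul_le_mul_of_nonneg_left h4 (show 0 ≤ q * x.im ^ 2 / 2 by positivity)
  calc 2 * q * x.im ^ 2 = q * x.im ^ 2 / 2 * 4 := by ring
    _ ≤ _ := h5
    _ = _ := by ring

/-! ### Moving a boundary point to infinity -/

/-- `SU(2,1)` acts transitively on the boundary: for a null vector `(a, b, 1)` the matrix
`!![a, conj b, 1; b, -1, 0; 1, 0, 0]` moves infinity to it. -/
theorem exists_moving_infPt (p : NullVec) :
    ∃ (P : SU21) (c : ℂ), c ≠ 0 ∧ mat P *ᵥ infPt.1 = c • p.1 := by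
  have hn := p.2.2
  simp only [herm] at hn
  by_cases h2 : p.1 2 = 0
  · have h1 : p.1 1 = 0 := by simpa [h2] using hn
    have h0 : p.1 0 ≠ 0 := by
      intro h0
      apply p.2.1
      ext i
      fin_cases i <;> simp [h0, h1, h2]
    refine ⟨1, (p.1 0)⁻¹, inv_ne_zero h0, ?_⟩
    rw [mat_one, one_mulVec]
    ext i
    fin_cases i <;> simp [infPt, h0, h1, h2]
  · have h2c : conj (p.1 2) ≠ 0 := by simpa using h2
    set a := p.1 0 / p.1 2 with ha
    set b := p.1 1 / p.1 2 with hb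
    have hab : a + b * conj b + conj a = 0 := by
      rw [ha, hb, map_div₀, map_div₀]
      field_simp
      linear_combination hn
    let M : SL(3, ℂ) := ⟨!![a, conj b, 1; b, -1, 0; 1, 0, 0], by rw [det_fin_three]; simp⟩
    have hM : M ∈ SU21 := by
      intro x y
      simp only [M, herm, mulVec, dotProduct, Fin.sum_univ_three]
      simp
      linear_combination (x 0 * conj (y 0)) * hab
    refine ⟨⟨M, hM⟩, (p.1 2)⁻¹, inv_ne_zero h2, ?_⟩
    ext i
    fin_cases i <;>
      simp [mat, M, infPt, mulVec, dotProduct, Fin.sum_univ_three, ha, hb, h2] <;> field_simp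

theorem eigen_conj_iff {P g : SU21} {v w : Fin 3 → ℂ} {c : ℂ} (hc : c ≠ 0)
    (hP : mat P *ᵥ v = c • w) (d : ℂ) :
    mat (P * g * P⁻¹) *ᵥ w = d • w ↔ mat g *ᵥ v = d • v := by
  have hw : w = c⁻¹ • (mat P *ᵥ v) := by rw [hP, smul_smul, inv_mul_cancel₀ hc, one_smul]
  have hv : mat P⁻¹ *ᵥ w = c⁻¹ • v := by
    rw [hw, mulVec_smul, mulVec_mulVec, mat_inv_mul, one_mulVec]
  have e : mat (P * g * P⁻¹) *ᵥ w = c⁻¹ • (mat P *ᵥ (mat g *ᵥ v)) := by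
    rw [mat_mul, mat_mul, ← mulVec_mulVec, hv, mulVec_smul, mulVec_mulVec]
  rw [e, hw, smul_comm d, ← mulVec_smul (mat P) d v]
  constructor
  · intro h
    have h1 := smul_right_injective _ (inv_ne_zero hc) h
    have h2 := congrArg (mat P⁻¹ *ᵥ ·) h1
    simpa only [mulVec_mulVec, mat_inv_mul, one_mulVec, one_mul, ← mul_assoc] using h2
  · intro h
    rw [h]

/-- Both sides of the defining inequality scale by `|den|²`, so the base vector moves by `g` and the
parameter stays. -/
theorem image_act_isHoroball (g : SU21) {B : Set (ℂ × ℂ)} (hB : IsHoroball B) :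
    IsHoroball (act g '' B) := by
  obtain ⟨p, r, hr, rfl⟩ := hB
  refine ⟨⟨mat g *ᵥ p.1, ?_, by rw [herm_mat]; exact p.2.2⟩, r, hr, ?_⟩
  · intro h
    apply p.2.1
    have := congrArg (mat g⁻¹ *ᵥ ·) h
    simpa only [mulVec_mulVec, mat_inv_mul, one_mulVec, mulVec_zero] using this
  have key : ∀ z ∈ plane, (r * ‖herm (lift (act g z)) (mat g *ᵥ p.1)‖ ^ 2 < height (act g z) ↔
      r * ‖herm (lift z) p.1‖ ^ 2 < height z) := by
    intro z hz
    have hd := den_ne_zero g hz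
    have hdn : 0 < ‖den g z‖ ^ 2 := by positivity
    have h1 : herm (lift z) p.1 = den g z * herm (lift (act g z)) (mat g *ᵥ p.1) := by
      rw [← herm_mat g, lift_act g hd]
      simp [herm]; ring
    rw [← height_act_mul g hd, h1, norm_mul, mul_pow, Complex.normSq_eq_norm_sq, mul_left_comm,
      mul_lt_mul_iff_right₀ hdn]
  ext z
  constructor
  · rintro ⟨w, hw, rfl⟩
    exact ⟨act_mem_plane g hw.1, (key w hw.1).2 hw.2⟩
  · rintro ⟨hz, hz'⟩
    have hw := act_mem_plane g⁻¹ hz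
    refine ⟨act g⁻¹ z, ⟨hw, (key _ hw).1 ?_⟩, act_act_inv g hz⟩
    rw [act_act_inv g hz]
    exact hz'

theorem quotientVolume_le_comap (P : SU21) (G : Subgroup SU21) {B : Set (ℂ × ℂ)}
    (hB : B ⊆ plane) : quotientVolume G B ≤
      quotientVolume (G.comap (MulAut.conj P).toMonoidHom) (act P⁻¹ '' B) := by
  refine iSup₂_le fun F hF => ?_
  have hFp := hF.2.1.trans hB
  rw [← vol_image_act P⁻¹ hFp hF.1]
  refine le_iSup₂_of_le (act P⁻¹ '' F) ⟨measurableSet_image_act _ hFp hF.1,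
    Set.image_mono hF.2.1, ?_⟩ le_rfl
  rintro _ ⟨x, hx, rfl⟩ _ ⟨y, hy, rfl⟩ g hg h
  have hg' : P * g * P⁻¹ ∈ G := hg
  congr 1
  refine hF.2.2 x hx y hy _ hg' ?_
  rw [act_mul _ _ (hFp hx), act_mul _ _ (act_mem_plane _ (hFp hx)), h, act_act_inv _ (hFp hy)]

end CHyp

end

/-! ### The general case, by conjugation to infinity -/

theorem mainTheorem8
    (Γ Γinf : Subgroup CHyp.SU21) (hdisc : DiscreteTopology Γ) (hle : Γinf ≤ Γ)
    (p : CHyp.NullVec) (hfix : ∀ g ∈ Γinf, CHyp.Fixes g p)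
    (Λ : Subgroup CHyp.SU21) (hΛ : Λ = Γinf ⊓ CHyp.heisenberg p)
    (m : ℕ) (hm : m = Λ.relIndex Γinf)
    (T : CHyp.SU21) (hT : CHyp.GeneratesCenter T Γinf)
    (q : ℕ)
    (hq : IsLeast {k : ℕ | 0 < k ∧ T ^ k ≠ 1 ∧ ∃ a ∈ Λ, ∃ b ∈ Λ, a * b * a⁻¹ * b⁻¹ = T ^ k} q)
    (C : CHyp.SU21) (hC : C ∈ Γ) (hC' : C ∉ Γinf)
    (B : Set (ℂ × ℂ)) (hB : CHyp.IsHoroball B) (hBinv : CHyp.PreciselyInvariant B Γinf Γ) :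
    (CHyp.mat (T * C * T * C⁻¹)).trace.im = 0 ∧
      CHyp.quotientVolume Γinf B ≤
        ENNReal.ofReal ((3 - (CHyp.mat (T * C * T * C⁻¹)).trace.re) * q / (2 * m)) := by
  open CHyp in
  subst hΛ hm
  obtain ⟨⟨hq0, hTq, a, ha, b, hb, hab⟩, -⟩ := hq
  obtain ⟨P, c, hc, hP⟩ := exists_moving_infPt p
  have hBp : B ⊆ plane := by
    obtain ⟨p', r, -, rfl⟩ := hB
    exact fun z hz => hz.1
  -- the generator agrees with an element of the group up to a scalar
  have : scalars.Normal := ⟨fun σ hσ g => by rwa [scalars_comm hσ, mul_inv_cancel_right]⟩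
  have hTs : T ∈ (Subgroup.center Γinf).map Γinf.subtype ⊔ scalars := by
    rw [hT.2]
    exact Subgroup.mem_sup_left (Subgroup.mem_zpowers T)
  obtain ⟨t, ⟨t, -, rfl⟩, σ, hσ, hTσ⟩ := Subgroup.mem_sup_of_normal_right.1 hTs
  have htT : T * σ⁻¹ = t := by rw [← hTσ]; exact mul_inv_cancel_right _ _
  have hTh : T ∈ heisenberg p := by
    refine ⟨?_, 1, by rw [one_smul]; exact hT.1⟩
    obtain ⟨d, hd⟩ := hfix t t.2
    obtain ⟨e, he⟩ := hσ
    refine ⟨e * d, ?_⟩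
    rw [← hTσ, mat_mul, he, Matrix.mul_smul, mul_one, Matrix.smul_mulVec]
    change e • (mat (t : SU21) *ᵥ p.1) = _
    rw [hd, smul_smul]
  have htΛ : T * σ⁻¹ ∈ Γinf ⊓ heisenberg p := ⟨htT ▸ t.2,
    (heisenberg p).mul_mem hTh ((heisenberg p).inv_mem (scalars_le_heisenberg p hσ))⟩
  -- Unipotence enters through the trace, which survives conjugation and later excludes a scalar
  -- factor.
  have htr : (mat T).trace = 3 := by
    have h := (Matrix.isNilpotent_trace_of_isNilpotent hT.1).eq_zero
    rw [Matrix.trace_sub, Matrix.trace_one, sub_eq_zero] at h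
    simpa using h
  have htrc : ∀ g : SU21, (mat (P⁻¹ * g * P)).trace = (mat g).trace := by
    intro g
    rw [mat_mul, Matrix.trace_mul_comm, ← mat_mul, ← mul_assoc, mul_inv_cancel, one_mul]
  -- transport to infinity
  set f := (MulAut.conj P).toMonoidHom with hf
  have hfa : ∀ g, f (P⁻¹ * g * P) = g := fun g => by simp [hf, mul_assoc]
  have hcomap : (Γinf ⊓ heisenberg p).comap f = Γinf.comap f ⊓ heisenberg infPt := by
    ext g
    refine and_congr_right fun _ => ?_
    refine (isHeisenbergTranslation_iff p _).trans
      (Iff.trans ?_ (isHeisenbergTranslation_iff infPt g).symm)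
    exact exists_congr fun d => and_congr_right fun _ => eigen_conj_iff hc hP d
  have hidx : (Γinf.comap f ⊓ heisenberg infPt).relIndex (Γinf.comap f)
      = (Γinf ⊓ heisenberg p).relIndex Γinf := by
    rw [← hcomap, Subgroup.relIndex_comap, Subgroup.map_comap_eq_self_of_surjective
      (MulAut.conj P).surjective]
  have hmem : ∀ g ∈ Γinf ⊓ heisenberg p, P⁻¹ * g * P ∈ Γinf.comap f ⊓ heisenberg infPt := by
    intro g hg
    rw [← hcomap, Subgroup.mem_comap, hfa]
    exact hg
  have hσ' : P⁻¹ * σ⁻¹ * P = σ⁻¹ := by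
    rw [scalars_comm (scalars.inv_mem hσ), inv_mul_cancel_right]
  have himg : ∀ g : SU21, act g '' (act P⁻¹ '' B) = act P⁻¹ '' (act (P * g * P⁻¹) '' B) := by
    intro g
    rw [← image_act_mul _ _ hBp, ← image_act_mul _ _ hBp]
    congr 2
    group
  have key := bound_at_infinity (G := Γinf.comap f)
    (fun g hg => by
      obtain ⟨d, hd⟩ := hfix _ hg
      exact ⟨d, (eigen_conj_iff hc hP d).1 hd⟩)
    (image_act_isHoroball P⁻¹ hB)
    (fun g hg => by
      rw [himg]
      exact congrArg (act P⁻¹ '' ·) (hBinv.1 _ hg))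
    (hmem a ha) (hmem b hb) (T := P⁻¹ * T * P) (σ := σ⁻¹)
    (by
      have := hmem _ htΛ
      have e : P⁻¹ * (T * σ⁻¹) * P = P⁻¹ * T * P * σ⁻¹ := by
        conv_rhs => rw [← hσ']
        group
      rwa [e] at this)
    (scalars.inv_mem hσ) ((htrc T).trans htr) hq0
    (by
      intro h
      apply hTq
      have e : (P⁻¹ * T * P) ^ q = P⁻¹ * T ^ q * P := by
        simpa using conj_pow (i := q) (a := P⁻¹) (b := T)
      rw [e] at h
      have := congrArg (fun g => P * g * P⁻¹) h
      simpa [mul_assoc] using this)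
    (by
      have e : (P⁻¹ * T * P) ^ q = P⁻¹ * T ^ q * P := by
        simpa using conj_pow (i := q) (a := P⁻¹) (b := T)
      rw [e, ← hab]
      group)
    (C := P⁻¹ * C * P)
    (by
      have h := hBinv.2 C hC hC'
      rw [himg]
      have e : P * (P⁻¹ * C * P) * P⁻¹ = C := by group
      rw [e]
      refine Set.disjoint_left.2 ?_
      rintro _ ⟨x, hx, rfl⟩ ⟨y, hy, hxy⟩
      have hyx := injOn_act P⁻¹ (hBp hy) (image_act_subset C hBp hx) hxy
      exact Set.disjoint_left.1 h hx (hyx ▸ hy))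
  have e : P⁻¹ * T * P * (P⁻¹ * C * P) * (P⁻¹ * T * P) * (P⁻¹ * C * P)⁻¹
      = P⁻¹ * (T * C * T * C⁻¹) * P := by group
  rw [e, htrc, hidx] at key
  exact ⟨key.1, (quotientVolume_le_comap P Γinf hBp).trans key.2⟩
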